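/- Let $\mathbb F_q$ be a finite field with $q$ elements, $A=\mathbb F_q[\theta]$, $K=\mathbb F_q(\theta)$, $K_\infty=\mathbb F_q((1/\theta))$ with the absolute value normalized by $|\theta|=q$, and let $\mathbb C_\infty$ be the completion of an algebraic closure of $K_\infty$ and $\Omega=\mathbb C_\infty\setminus K_\infty$. Put $[i]=\theta^{q^i}-\theta$, $D_0=1$, $D_i=[i][i-1]^q\cdots[1]^{q^{i-1}}$, and let $e_C(z)=\sum_{i\ge0}z^{q^i}/D_i$ be the Carlitz exponential. Fix a $(q-1)$-st root $(-\theta)^{1/(q-1)}$ of $-\theta$ in $\mathbb C_\infty$ and let $\tilde\pi=\theta(-\theta)^{1/(q-1)}\prod_{i\ge1}(1-\theta^{1-q^i})^{-1}$ be the Carlitz period and $\Lambda_C=A\tilde\pi$. For $z\in\Omega$ put $u(z)=1/e_C(\tilde\pi z)$. For a holomorphic (rigid analytic) function $f$ on $\Omega$ and $r\ge0$, let $\partial_z^r f$ be the $r$-th hyperderivative, so that $f(z)=\sum_{r\ge0}(\partial_z^rf)(c)\,(z-c)^r$ near each $c\in\Omega$, and let $\Theta^r f=(-\tilde\pi)^{-r}\,\partial_z^r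 f$. On Laurent polynomials in $u$, $\partial_u^j$ is the linear operator with $\partial_u^j(u^m)=\binom mj u^{m-j}$ for $m\in\mathbb Z$, where $\binom mj=m(m-1)\cdots(m-j+1)/j!$. For $k\ge1$ let $G_k(t)\in\mathbb C_\infty[t]$ be the $k$-th Goss polynomial of $\Lambda_C$: the unique monic polynomial of degree $k$ with $$\sum_{\lambda\in\Lambda_C}\frac1{(z-\lambda)^k}=G_k\Bigl(\frac1{e_{\Lambda_C}(z)}\Bigr)\quad(z\in\mathbb C_\infty\setminus\Lambda_C),\qquad e_{\Lambda_C}(z)=z\prod_{0\ne\lambda\in\Lambda_C}\Bigl(1-\frac z\lambda\Bigr).$$ Let $r\ge0$. Then $G_{r+1}$ exists and is unique, and it has the form $G_{r+1}(t)=\sum_{j=0}^r\beta_{r,j}t^{j+1}$; the functions $u^n$ ($n\ge0$) are holomorphic on $\Omega$; and the following identities hold on $\Omega$: $$\Theta^r(u^n)=u^n\,\partial_u^{n-1}\bigl(u^{n-2}G_{r+1}(u)\bigr)\qquad\text{for all } n\ge1,$$ $$\Theta^r(u^n)=\sum_{j=0}^r\beta_{r,j}\,u^{j+1}\,\partial_u^j\bigl(u^{n+j-1}\bigr)=\sum_{j=0}^r\binom{n+j-1}{j}\beta_{r,j}\,u^{n+j}\qquad\text{for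 all } n\ge0.$$ -/

import Mathlib

open Polynomial Filter Topology
open scoped LaurentPolynomial NNReal WithZero

noncomputable section

namespace Drinfeld

/-! ### The field `ℂ_∞` -/

section Field

/-- `K_∞ = F((1/θ))`: the completion of `K = F(θ)` at its infinite place; the variable of
`RatFunc F` plays the role of `θ`. -/
abbrev KInfty (F : Type*) [Field F] : Type _ :=
  @RatFunc.CompletionAtInfty F _ (Classical.decEq _)

lemma valuation_theta (F : Type*) [Field F] :
    (Valued.v : Valuation (KInfty F) ℤᵐ⁰) (algebraMap (RatFunc F) (KInfty F) RatFunc.X) =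
      WithZero.exp 1 := by
  let _ : DecidableEq (RatFunc F) := Classical.decEq _
  let _ := RatFunc.inftyValued F
  rw [← RatFunc.inftyValuation.X F]
  exact Valued.extensionValuation_apply_coe (K := RatFunc F) RatFunc.X

variable (F : Type*) [Field F] [Finite F]

lemma one_lt_card : (1 : ℝ≥0) < (Nat.card F : ℝ≥0) := by
  exact_mod_cast Finite.one_lt_card

open MonoidWithZeroHom.ValueGroup₀ in
/-- The valuation of `K_∞` is turned into an absolute value with `|θ| = q`, where `q = #F`. -/
instance rankOneKInfty : (Valued.v : Valuation (KInfty F) ℤᵐ⁰).RankOne where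
  hom' := (WithZeroMulInt.toNNReal (one_lt_card F).ne_zero).comp embedding
  strictMono' := (WithZeroMulInt.toNNReal_strictMono (one_lt_card F)).comp embedding_strictMono
  exists_val_nontrivial :=
    ⟨algebraMap (RatFunc F) (KInfty F) RatFunc.X, by simp [valuation_theta]⟩

instance nontriviallyNormedFieldKInfty : NontriviallyNormedField (KInfty F) :=
  Valued.toNontriviallyNormedField (KInfty F) ℤᵐ⁰

instance isUltrametricDistKInfty : IsUltrametricDist (KInfty F) :=
  Valued.instIsUltrametricDist (KInfty F) ℤᵐ⁰

instance completeSpaceKInfty : CompleteSpace (KInfty F) := by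
  let _ : DecidableEq (RatFunc F) := Classical.decEq _
  let _ := RatFunc.inftyValued F
  exact inferInstanceAs (CompleteSpace (UniformSpace.Completion (RatFunc F)))

/-- An algebraic closure of `K_∞`, normed by the unique extension of the absolute value. -/
abbrev KInftyAlg : Type _ := AlgebraicClosure (KInfty F)

instance nontriviallyNormedFieldKInftyAlg : NontriviallyNormedField (KInftyAlg F) :=
  spectralNorm.nontriviallyNormedField (KInfty F) (KInftyAlg F)

instance normedAlgebraKInftyAlg : NormedAlgebra (KInfty F) (KInftyAlg F) :=
  spectralNorm.normedAlgebra (KInfty F) (KInftyAlg F)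

/-- `ℂ_∞`: the completion of an algebraic closure of `K_∞`. -/
abbrev CInfty : Type _ := UniformSpace.Completion (KInftyAlg F)

instance nontriviallyNormedFieldCInfty : NontriviallyNormedField (CInfty F) where
  __ := (inferInstance : NormedField (CInfty F))
  non_trivial := by
    obtain ⟨x, hx⟩ := NontriviallyNormedField.non_trivial (α := KInftyAlg F)
    exact ⟨x, by rwa [UniformSpace.Completion.norm_coe]⟩

/-- The inclusion of `A = F[θ]` in `ℂ_∞`. -/
def ofA : F[X] →+* CInfty F :=
  (algebraMap (KInfty F) (CInfty F)).comp
    ((algebraMap (RatFunc F) (KInfty F)).comp (algebraMap F[X] (RatFunc F)))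

/-- The element `θ` of `ℂ_∞`. -/
def theta : CInfty F := ofA F X

end Field

/-! ### Holomorphic functions on the Drinfeld upper half-plane, and hyperderivatives -/

section Analysis

variable {F : Type*} [Field F] [Finite F]

variable (F) in
/-- The Drinfeld upper half-plane `Ω = ℂ_∞ ∖ K_∞`. -/
def upperHalfPlane : Set (CInfty F) :=
  (Set.range (algebraMap (KInfty F) (CInfty F)))ᶜ

variable (F) in
/-- The standard admissible covering of `Ω` by the affinoids
`Ω_n = {z : |z| ≤ q ^ n, |z - x| ≥ q ^ (-n) for all x ∈ K_∞}`. -/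
def affinoid (n : ℕ) : Set (CInfty F) :=
  {z | ‖z‖ ≤ (Nat.card F : ℝ) ^ n ∧
    ∀ x : KInfty F, ((Nat.card F : ℝ) ^ n)⁻¹ ≤ ‖z - algebraMap (KInfty F) (CInfty F) x‖}

/-- `f` is holomorphic (rigid analytic) on `Ω`: on each `Ω_n` it is a uniform limit of rational
functions without poles on `Ω_n`. Only the values of `f` on `Ω` matter. -/
def IsHolomorphic (f : CInfty F → CInfty F) : Prop :=
  ∀ n : ℕ, ∃ P Q : ℕ → (CInfty F)[X],
    (∀ m, ∀ z ∈ affinoid F n, (Q m).eval z ≠ 0) ∧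
    TendstoUniformlyOn (fun m z => (P m).eval z / (Q m).eval z) f atTop (affinoid F n)

open Classical in
/-- The hyperderivative `∂_z ^ j (f)`: its value at `c` is the coefficient of `(z - c) ^ j` in the
Taylor expansion of `f` at `c` (and `0` if `f` has no Taylor expansion at `c`). -/
def hyperDeriv (j : ℕ) (f : CInfty F → CInfty F) (c : CInfty F) : CInfty F :=
  if h : ∃ p, HasFPowerSeriesAt (𝕜 := CInfty F) f p c then h.choose.coeff j else 0

lemma hyperDeriv_eq {f : CInfty F → CInfty F} {c : CInfty F}
    {p : FormalMultilinearSeries (CInfty F) (CInfty F) (CInfty F)}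
    (h : HasFPowerSeriesAt f p c) (j : ℕ) : hyperDeriv j f c = p.coeff j := by
  have h' : ∃ p, HasFPowerSeriesAt (𝕜 := CInfty F) f p c := ⟨p, h⟩
  rw [hyperDeriv, dif_pos h', h'.choose_spec.eq_formalMultilinearSeries h]

end Analysis

/-! ### Formal hyperderivatives of Laurent polynomials -/

section Formal

variable {R : Type*}

/-- The hyperderivative `∂ ^ j` on Laurent polynomials: linear, with
`∂ ^ j (T ^ m) = (m choose j) T ^ (m - j)` for all integers `m`. -/
def laurentHyperDeriv [CommRing R] (j : ℕ) (f : R[T;T⁻¹]) : R[T;T⁻¹] :=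
  f.coeff.sum fun m a =>
    LaurentPolynomial.C (Ring.choose m j • a) * LaurentPolynomial.T (m - (j : ℤ))

/-- The value of a Laurent polynomial at `x` (of interest for `x ≠ 0`). -/
def laurentEval [Field R] (x : R) (f : R[T;T⁻¹]) : R :=
  f.coeff.sum fun m a => a * x ^ m

end Formal

/-! ### The Carlitz exponential, its period, and the parameter at infinity -/

section Carlitz

variable {F : Type*} [Field F] [Finite F]

variable (F) in
/-- `[i] = θ ^ (q ^ i) - θ`. -/
def bracket (i : ℕ) : CInfty F := theta F ^ Nat.card F ^ i - theta F

variable (F) in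
/-- `D_i = [i] [i - 1] ^ q ⋯ [1] ^ (q ^ (i - 1))`, with `D_0 = 1`. -/
def carlitzD (i : ℕ) : CInfty F :=
  ∏ j ∈ Finset.range i, bracket F (i - j) ^ Nat.card F ^ j

/-- The Carlitz exponential `e_C(z) = ∑ z ^ (q ^ i) / D_i`. -/
def carlitzExp (z : CInfty F) : CInfty F :=
  ∑' i : ℕ, z ^ Nat.card F ^ i / carlitzD F i

/-- The Carlitz period `θ (-θ)^{1/(q-1)} ∏_{i ≥ 1} (1 - θ ^ (1 - q ^ i))⁻¹`, where `ξ` stands for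
the chosen `(q-1)`-st root of `-θ`. -/
def carlitzPeriod (ξ : CInfty F) : CInfty F :=
  theta F * ξ * ∏' i : ℕ, (1 - theta F ^ (1 - (Nat.card F : ℤ) ^ (i + 1)))⁻¹

/-- The lattice `Λ_C = A π̃`. -/
def carlitzLattice (ξ : CInfty F) : Set (CInfty F) :=
  Set.range fun a : F[X] => ofA F a * carlitzPeriod ξ

/-- The parameter at the infinite cusp, `u(z) = 1 / e_C(π̃ z)`. -/
def uParam (ξ : CInfty F) (z : CInfty F) : CInfty F :=
  1 / carlitzExp (carlitzPeriod ξ * z)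

/-- The operator `Θ ^ r = (-π̃) ^ (-r) ∂_z ^ r`. -/
def thetaOp (ξ : CInfty F) (r : ℕ) (f : CInfty F → CInfty F) (z : CInfty F) : CInfty F :=
  1 / (-carlitzPeriod ξ) ^ r * hyperDeriv r f z

end Carlitz

/-! ### Goss polynomials -/

section Goss

variable {F : Type*} [Field F] [Finite F]

/-- `e_Λ(z) = z ∏' (1 - z / λ)`, the product being over the nonzero `λ ∈ Λ`. -/
def latticeExp (Λ : Set (CInfty F)) (z : CInfty F) : CInfty F :=
  z * ∏' l : {l : CInfty F // l ∈ Λ ∧ l ≠ 0}, (1 - z / l.1)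

/-- `G` is the `k`-th Goss polynomial of `Λ`: it is monic of degree `k`, and
`∑_{λ ∈ Λ} 1 / (z - λ) ^ k = G(t_Λ(z))` off `Λ`, where `t_Λ = 1 / e_Λ`. -/
structure IsGossPolynomial (Λ : Set (CInfty F)) (k : ℕ) (G : (CInfty F)[X]) : Prop where
  monic : G.Monic
  natDegree_eq : G.natDegree = k
  hasSum : ∀ z, z ∉ Λ →
    HasSum (fun l : Λ => 1 / (z - (l : CInfty F)) ^ k) (G.eval (1 / latticeExp Λ z))

open Classical in
/-- The `k`-th Goss polynomial `G_k` of the lattice `Λ_C` (for `k ≥ 1`). -/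
def carlitzGoss (ξ : CInfty F) (k : ℕ) : (CInfty F)[X] :=
  if h : ∃ G, IsGossPolynomial (carlitzLattice ξ) k G then h.choose else 0

/-- The coefficients `β_{r,j}` in `G_{r+1}(t) = ∑_{j ≤ r} β_{r,j} t ^ (j + 1)`. -/
def gossCoeff (ξ : CInfty F) (r j : ℕ) : CInfty F :=
  (carlitzGoss ξ (r + 1)).coeff (j + 1)

end Goss

end Drinfeld

end

noncomputable section

namespace Drinfeld

/-! ### Absolute values of polynomials in `ℂ_∞` -/

section Norms

/-! Everything is read off from one generating function. The Carlitz exponential `e_C` is additive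
and odd, so expanding `u` at `z` with increment `-X/π̃` gives `u(z - X/π̃) = 1/(e_C(π̃z) - e_C(X))`.
The factor `(-π̃)^(-r)` in `Θ^r` is exactly this rescaling, hence `∑_r Θ^r(u^n) X^r = (e_C(π̃z) -
e_C(X))^(-n) = ∑_j binom(n+j-1, j) u^(n+j) e_C(X)^j`.

The case `n = 1` also governs the Goss polynomials. The derivative of `e_C` is `1`, so `1/(e_C(w) -
e_C(X))` is, up to sign, the logarithmic derivative in `X` of `e_C(w - X)`, namely `∑_λ 1/(w - λ -
X)`. Its coefficient at `X^r` is `∑_λ 1/(w - λ)^(r+1)`. Therefore `β_{r,j}` is the coefficient of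
`X^r` in `e_C(X)^j`; this proves the binomial formula, and the other two only rewrite binomial
coefficients.

The remaining input is that `e_C` is the lattice function of `Λ_C`, with the given product for `π̃`.
It comes from finite level: the polynomial `e_d(z) = z ∏ (1 - z/a)`, over nonzero `a` of degree less
than `d`, has explicit coefficients (`addPoly_eq_prod`, `addPoly_eq_sum`), and `π̃ e_d(z)` tends to
`e_C(π̃z)` (`tendsto_addPoly`). The logarithmic derivative is also taken at finite level
(`sum_invUnitsSub_mul`) and passed to the limit in `isGossPolynomial_gossPoly`; the expansion of
`u^n` is `thetaOp_uParam_pow`. Holomorphy of `u^n` rests on the exact norm of `e_C(π̃z)` in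
`norm_carlitzExp`. -/

instance isUltrametricDistCInfty (F : Type*) [Field F] [Finite F] : IsUltrametricDist (CInfty F) :=
  IsUltrametricDist.of_normedAlgebra (KInfty F)

lemma valuation_polynomial {F : Type*} [Field F] {a : F[X]} (ha : a ≠ 0) :
    (Valued.v : Valuation (KInfty F) ℤᵐ⁰)
      (algebraMap (RatFunc F) (KInfty F) (algebraMap F[X] (RatFunc F) a)) =
      WithZero.exp (a.natDegree : ℤ) := by
  let _ : DecidableEq (RatFunc F) := Classical.decEq _
  let _ := RatFunc.inftyValued F
  rw [← RatFunc.inftyValuation.polynomial F ha]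
  exact Valued.extensionValuation_apply_coe (K := RatFunc F) _

variable {F : Type*} [Field F] [Finite F]

lemma norm_of_valuation_eq_exp {x : KInfty F} {n : ℤ}
    (h : (Valued.v : Valuation (KInfty F) ℤᵐ⁰) x = WithZero.exp n) :
    ‖x‖ = (Nat.card F : ℝ) ^ n := by
  have h1 : ‖x‖ = ((WithZeroMulInt.toNNReal (one_lt_card F).ne_zero) (Valued.v x) : ℝ≥0) := by
    rw [Valued.toNormedField.norm_def]
    change ((WithZeroMulInt.toNNReal (one_lt_card F).ne_zero)
      (MonoidWithZeroHom.ValueGroup₀.embedding (Valued.v.restrict x)) : ℝ) = _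
    rw [Valuation.embedding_restrict]
  rw [h1, h, WithZeroMulInt.toNNReal_neg_apply _ (by simp)]
  simp
  rfl

lemma norm_ofA {a : F[X]} (ha : a ≠ 0) : ‖ofA F a‖ = (Nat.card F : ℝ) ^ a.natDegree := by
  rw [← zpow_natCast, ← norm_of_valuation_eq_exp (valuation_polynomial ha)]
  exact norm_algebraMap' (CInfty F) (_ : KInfty F)

lemma norm_theta : ‖theta F‖ = Nat.card F := by
  simpa [theta] using norm_ofA (F := F) X_ne_zero

lemma ofA_injective : Function.Injective (ofA F) := by
  refine (injective_iff_map_eq_zero _).2 fun a ha => by_contra fun h => ?_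
  have := norm_ofA h
  rw [ha, norm_zero] at this
  exact (pow_pos (by exact_mod_cast Nat.card_pos) _).ne this

end Norms

/-! ### The additive polynomials vanishing at polynomials of bounded degree -/

section CarlitzPolynomials

variable {F : Type*} [Field F] [Finite F]

/-- The `q`-th power map of a commutative ring that contains the field with `q` elements. -/
def frob {R : Type*} [CommRing R] (φ : F →+* R) : R →+* R :=
  let _ := φ.toAlgebra
  let _ := Fintype.ofFinite F
  (FiniteField.frobeniusAlgHom F R).toRingHom

lemma frob_apply {R : Type*} [CommRing R] (φ : F →+* R) (x : R) :
    frob φ x = x ^ Nat.card F := by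
  let _ := φ.toAlgebra
  let _ := Fintype.ofFinite F
  rw [Nat.card_eq_fintype_card]
  rfl

lemma pow_card_of_field (c : F) : c ^ Nat.card F = c := by
  let _ := Fintype.ofFinite F
  rw [Nat.card_eq_fintype_card, FiniteField.pow_card]

lemma natCast_card_eq_zero {R : Type*} [CommRing R] (φ : F →+* R) : (Nat.card F : R) = 0 := by
  let _ := Fintype.ofFinite F
  rw [Nat.card_eq_fintype_card, ← map_natCast φ, FiniteField.cast_card_eq_zero, map_zero]

variable (F) in
lemma card_pos' : 0 < Nat.card F := Nat.card_pos

variable {L : Type*} [Field L]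

lemma add_pow_card (ι : F[X] →+* L) (x y : L) : (x + y) ^ Nat.card F = x ^ Nat.card F + y ^ Nat.card F := by
  simp only [← frob_apply (ι.comp C), map_add]

lemma sub_pow_card (ι : F[X] →+* L) (x y : L) : (x - y) ^ Nat.card F = x ^ Nat.card F - y ^ Nat.card F := by
  simp only [← frob_apply (ι.comp C), map_sub]

lemma neg_pow_card (ι : F[X] →+* L) (x : L) : (-x) ^ Nat.card F = -x ^ Nat.card F := by
  simp only [← frob_apply (ι.comp C), map_neg]

variable (ι : F[X] →+* L)

/-- `[i] = θ ^ (q ^ i) - θ`, where `θ` is the image of the variable. -/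
def brk (i : ℕ) : L := ι X ^ Nat.card F ^ i - ι X

/-- `L_d = [1] [2] ⋯ [d]`. -/
def facL (d : ℕ) : L := ∏ j ∈ Finset.range d, brk ι (j + 1)

/-- `D_i = [i] [i - 1] ^ q ⋯ [1] ^ (q ^ (i - 1))`. -/
def facD (i : ℕ) : L := ∏ j ∈ Finset.range i, brk ι (i - j) ^ Nat.card F ^ j

/-- The additive polynomial with linear coefficient `1` that vanishes at the elements of `F[θ]`
of degree less than `d`. -/
def addPoly : ℕ → L[X]
  | 0 => X
  | d + 1 => addPoly d - C ((facL ι d ^ (Nat.card F - 1))⁻¹) * addPoly d ^ Nat.card F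

lemma facL_succ (d : ℕ) : facL ι (d + 1) = facL ι d * brk ι (d + 1) := Finset.prod_range_succ _ _

lemma facD_succ (i : ℕ) : facD ι (i + 1) = brk ι (i + 1) * facD ι i ^ Nat.card F := by
  rw [facD, Finset.prod_range_succ', facD, ← Finset.prod_pow, mul_comm]
  simp only [pow_zero, Nat.sub_zero, pow_one, Nat.add_sub_add_right]
  congr 1
  exact Finset.prod_congr rfl fun j _ => by rw [← pow_mul, ← pow_succ]

lemma brk_pow (d : ℕ) : brk ι d ^ Nat.card F = brk ι (d + 1) - brk ι 1 := by
  rw [brk, sub_pow_card ι, ← pow_mul, ← pow_succ, brk, brk]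
  ring

lemma brk_pow_pow (d i : ℕ) : brk ι d ^ Nat.card F ^ i = brk ι (d + i) - brk ι i := by
  induction i with
  | zero => simp [brk]
  | succ i ih =>
    rw [pow_succ, pow_mul, ih, sub_pow_card ι, brk_pow, brk_pow, ← add_assoc]
    ring

variable {ι}

lemma brk_ne_zero (hι : Function.Injective ι) (i : ℕ) : brk ι (i + 1) ≠ 0 := by
  rw [brk, ← map_pow, ← map_sub, map_ne_zero_iff ι hι]
  have h1 : 1 < Nat.card F ^ (i + 1) := Nat.one_lt_pow (by simp) Finite.one_lt_card
  refine sub_ne_zero.2 fun h => h1.ne' ?_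
  simpa using congrArg natDegree h

lemma facL_ne_zero (hι : Function.Injective ι) (d : ℕ) : facL ι d ≠ 0 :=
  Finset.prod_ne_zero_iff.2 fun j _ => brk_ne_zero hι j

lemma facD_ne_zero (hι : Function.Injective ι) (d : ℕ) : facD ι d ≠ 0 := by
  induction d with
  | zero => simp [facD]
  | succ d ih => rw [facD_succ]; exact mul_ne_zero (brk_ne_zero hι d) (pow_ne_zero _ ih)

lemma pow_card_eq_mul {M : Type*} [Monoid M] (x : M) :
    x ^ Nat.card F = x ^ (Nat.card F - 1) * x := by
  rw [← pow_succ, Nat.sub_add_cancel (card_pos' F)]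

variable (ι)

lemma eval_addPoly_succ (d : ℕ) (x : L) :
    (addPoly ι (d + 1)).eval x = (addPoly ι d).eval x -
      (facL ι d ^ (Nat.card F - 1))⁻¹ * (addPoly ι d).eval x ^ Nat.card F := by
  simp [addPoly]

lemma eval_addPoly_add (d : ℕ) (x y : L) :
    (addPoly ι d).eval (x + y) = (addPoly ι d).eval x + (addPoly ι d).eval y := by
  induction d with
  | zero => simp [addPoly]
  | succ d ih => simp only [eval_addPoly_succ, ih, add_pow_card ι]; ring

lemma eval_addPoly_C_mul (d : ℕ) (c : F) (x : L) :
    (addPoly ι d).eval (ι (C c) * x) = ι (C c) * (addPoly ι d).eval x := by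
  induction d with
  | zero => simp [addPoly]
  | succ d ih =>
    have : ι (C c) ^ Nat.card F = ι (C c) := by
      rw [← map_pow, ← C_pow, pow_card_of_field]
    simp only [eval_addPoly_succ, ih, mul_pow, this]; ring

variable {ι}

/-- This relation replaces the evaluation of `e_d` at `θ^d`: it carries vanishing at `x`, of both
`e_d` and `e_{d+1}`, to vanishing of `e_{d+1}` at `θx`. The induction uses `θ^q = θ + [1]` and
`[d+2] = [d+1]^q + [1]`. -/
lemma eval_addPoly_theta_mul (hι : Function.Injective ι) (d : ℕ) (x : L) :
    (addPoly ι (d + 1)).eval (ι X * x) = ι X * (addPoly ι (d + 1)).eval x -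
      brk ι (d + 1) * (facL ι d ^ (Nat.card F - 1))⁻¹ * (addPoly ι d).eval x ^ Nat.card F := by
  induction d with
  | zero => simp [addPoly, facL, brk]; ring
  | succ d ih =>
    rw [eval_addPoly_succ, ih, sub_pow_card ι, eval_addPoly_succ ι (d + 1), mul_pow, mul_pow,
      mul_pow, facL_succ]
    have h2 : (ι X : L) ^ Nat.card F = brk ι 1 + ι X := by simp [brk]
    have h3 := brk_pow ι (d + 1)
    have h4 : (addPoly ι (d + 1)).eval x ^ Nat.card F = (addPoly ι d).eval x ^ Nat.card F -
        ((facL ι d ^ (Nat.card F - 1))⁻¹) ^ Nat.card F *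
          ((addPoly ι d).eval x ^ Nat.card F) ^ Nat.card F := by
      rw [eval_addPoly_succ, sub_pow_card ι, mul_pow]
    have h5 : brk ι (d + 1) * (facL ι d ^ (Nat.card F - 1))⁻¹ =
        ((facL ι d * brk ι (d + 1)) ^ (Nat.card F - 1))⁻¹ * brk ι (d + 1) ^ Nat.card F := by
      have := brk_ne_zero hι d
      rw [mul_pow, pow_card_eq_mul (F := F) (brk ι (d + 1))]
      field_simp
    have h6 : brk ι (d + 1 + 1) = brk ι (d + 1) ^ Nat.card F + brk ι 1 := by rw [h3]; ring
    rw [h2, h6]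
    linear_combination (((facL ι d * brk ι (d + 1)) ^ (Nat.card F - 1))⁻¹ *
      brk ι (d + 1) ^ Nat.card F) * h4 - (addPoly ι d).eval x ^ Nat.card F * h5

lemma eval_addPoly_theta_pow (hι : Function.Injective ι) {j d : ℕ} (h : j < d) :
    (addPoly ι d).eval (ι X ^ j) = 0 := by
  induction j generalizing d with
  | zero =>
    induction d with
    | zero => omega
    | succ d ih =>
      rcases d with _ | d
      · simp [addPoly, facL]
      · rw [eval_addPoly_succ, ih (by omega)]
        simp [(card_pos' F).ne']
  | succ j ih =>
    obtain ⟨d, rfl⟩ : ∃ e, d = e + 1 := ⟨d - 1, by omega⟩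
    rw [pow_succ', eval_addPoly_theta_mul hι, ih (by omega), ih (by omega)]
    simp [(card_pos' F).ne']

lemma eval_addPoly_of_degree_lt (hι : Function.Injective ι) {a : F[X]} {d : ℕ}
    (h : a.degree < d) : (addPoly ι d).eval (ι a) = 0 := by
  let f : L →+ L := ⟨⟨fun x => (addPoly ι d).eval x, by
    simpa using eval_addPoly_add ι d 0 0⟩, eval_addPoly_add ι d⟩
  change f (ι a) = 0
  rw [a.as_sum_range_C_mul_X_pow, map_sum, map_sum]
  refine Finset.sum_eq_zero fun j hj => ?_
  change (addPoly ι d).eval (ι _) = 0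
  rcases eq_or_ne a 0 with rfl | ha
  · simp at hj
    simpa using eval_addPoly_add ι d 0 0
  · rw [map_mul, eval_addPoly_C_mul, map_pow, eval_addPoly_theta_pow hι, mul_zero]
    have := (natDegree_lt_iff_degree_lt ha).2 h
    have := Finset.mem_range.1 hj
    omega

variable (F) in
/-- The polynomials of degree less than `d`. -/
def polysLT (d : ℕ) : Finset F[X] :=
  have : Finite (degreeLT F d) := Finite.of_equiv _ (degreeLTEquiv F d).symm.toEquiv
  (Set.toFinite (degreeLT F d : Set F[X])).toFinset

lemma mem_polysLT {d : ℕ} {a : F[X]} : a ∈ polysLT F d ↔ a.degree < d := by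
  simp [polysLT, mem_degreeLT]

lemma card_polysLT (d : ℕ) : (polysLT F d).card = Nat.card F ^ d := by
  have : Finite (degreeLT F d) := Finite.of_equiv _ (degreeLTEquiv F d).symm.toEquiv
  rw [polysLT, ← Nat.card_eq_card_finite_toFinset]
  have := Nat.card_congr (degreeLTEquiv F d).toEquiv
  rw [Nat.card_fun, Nat.card_fin] at this
  exact this

variable (ι)

lemma natDegree_addPoly_le (d : ℕ) : (addPoly ι d).natDegree ≤ Nat.card F ^ d := by
  induction d with
  | zero => simp [addPoly]
  | succ d ih =>
    refine (natDegree_sub_le _ _).trans (max_le (ih.trans ?_) ?_)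
    · exact Nat.pow_le_pow_right (card_pos' F) (Nat.le_succ d)
    · refine (natDegree_C_mul_le _ _).trans (natDegree_pow_le.trans ?_)
      rw [pow_succ']
      exact Nat.mul_le_mul_left _ ih

/-- The recursion only adds multiples of `q`-th powers, whose derivative vanishes in characteristic
dividing `q`. -/
lemma derivative_addPoly (d : ℕ) : derivative (addPoly ι d) = 1 := by
  induction d with
  | zero => simp [addPoly]
  | succ d ih =>
    simp [addPoly, ih, derivative_pow, natCast_card_eq_zero (ι.comp C)]

/-- Additivity as an identity in `X`: the right side has derivative `-1`, while the left side
factors with roots `z - a`. Comparing the two is the source of the logarithmic derivative formula.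
-/
lemma addPoly_comp_C_sub_X (d : ℕ) (z : L) :
    (addPoly ι d).comp (C z - X) = C ((addPoly ι d).eval z) - addPoly ι d := by
  induction d with
  | zero => simp [addPoly]
  | succ d ih =>
    have h (x y : L[X]) : (x - y) ^ Nat.card F = x ^ Nat.card F - y ^ Nat.card F := by
      simp only [← frob_apply ((C : L →+* L[X]).comp (ι.comp C)), map_sub]
    rw [eval_addPoly_succ, addPoly]
    simp only [sub_comp, mul_comp, pow_comp, C_comp, ih, h, map_sub, map_mul, map_pow]
    ring

variable {ι}

/-- The `q^d` distinct known roots already exhaust the degree bound, so the cofactor is constant. -/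
lemma addPoly_eq_prod (hι : Function.Injective ι) (d : ℕ) :
    ∃ k : L, addPoly ι d = C k * ∏ a ∈ polysLT F d, (X - C (ι a)) := by
  have h1 : ∏ a ∈ polysLT F d, (X - C (ι a)) ∣ addPoly ι d := by
    refine Finset.prod_dvd_of_coprime (fun a _ b _ hab => ?_) fun a ha => ?_
    · exact pairwise_coprime_X_sub_C hι hab
    · exact dvd_iff_isRoot.2 (eval_addPoly_of_degree_lt hι (mem_polysLT.1 ha))
  obtain ⟨r, hr⟩ := h1
  have hm : (∏ a ∈ polysLT F d, (X - C (ι a))).Monic := monic_prod_of_monic _ _ fun a _ =>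
    monic_X_sub_C _
  have h0 : r ≠ 0 := by
    rintro rfl
    have := derivative_addPoly ι d
    simp [hr] at this
  have h2 := natDegree_addPoly_le ι d
  rw [hr, hm.natDegree_mul' h0, natDegree_prod_of_monic _ _ fun a _ => monic_X_sub_C _] at h2
  simp only [natDegree_X_sub_C, Finset.sum_const, card_polysLT, smul_eq_mul, mul_one] at h2
  refine ⟨r.coeff 0, ?_⟩
  rw [← eq_C_of_natDegree_eq_zero (by omega), hr, mul_comm]

-- The constant of `addPoly_eq_prod` is fixed by the derivative at `0` being `1`.
open Classical in
lemma eval_addPoly_eq_prod (hι : Function.Injective ι) (d : ℕ) (z : L) :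
    (addPoly ι d).eval z = z * ∏ a ∈ (polysLT F d).erase 0, (1 - z / ι a) := by
  obtain ⟨k, hk⟩ := addPoly_eq_prod hι d
  have h0 : (0 : F[X]) ∈ polysLT F d := mem_polysLT.2 (by simp)
  have hz (z : L) : (addPoly ι d).eval z =
      z * (k * ∏ a ∈ (polysLT F d).erase 0, (z - ι a)) := by
    rw [hk, ← Finset.mul_prod_erase _ _ h0]
    simp [eval_prod]
    ring
  have h1 : k * ∏ a ∈ (polysLT F d).erase 0, (-ι a) = 1 := by
    have := congrArg (eval 0) (derivative_addPoly ι d)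
    rw [hk, ← Finset.mul_prod_erase _ _ h0] at this
    simpa [derivative_mul, eval_prod] using this
  have h2 : ∏ a ∈ (polysLT F d).erase 0, (z - ι a) =
      (∏ a ∈ (polysLT F d).erase 0, (-ι a)) * ∏ a ∈ (polysLT F d).erase 0, (1 - z / ι a) := by
    rw [← Finset.prod_mul_distrib]
    refine Finset.prod_congr rfl fun a ha => ?_
    have : ι a ≠ 0 := (map_ne_zero_iff ι hι).2 (Finset.ne_of_mem_erase ha)
    field_simp
    ring
  rw [hz, h2, ← mul_assoc k, h1, one_mul]

/-- The explicit coefficients of `addPoly ι d`. -/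
lemma addPoly_eq_sum (hι : Function.Injective ι) (d : ℕ) :
    addPoly ι d = ∑ i ∈ Finset.range (d + 1),
      C ((-1) ^ i * facL ι d / (facL ι (d - i) ^ Nat.card F ^ i * facD ι i)) *
        X ^ Nat.card F ^ i := by
  induction d with
  | zero => simp [addPoly, facL, facD]
  | succ d ih =>
    have hfr (i : ℕ) (x : L) : (C x * X ^ Nat.card F ^ i) ^ Nat.card F =
        C (x ^ Nat.card F) * X ^ Nat.card F ^ (i + 1) := by
      rw [mul_pow, ← C_pow, ← pow_mul, ← pow_succ]
    have hL := facL_ne_zero hι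
    have hD := facD_ne_zero hι
    have hpow : addPoly ι d ^ Nat.card F = ∑ i ∈ Finset.range (d + 1),
        C (((-1) ^ i * facL ι d / (facL ι (d - i) ^ Nat.card F ^ i * facD ι i)) ^ Nat.card F) *
          X ^ Nat.card F ^ (i + 1) := by
      rw [ih, ← frob_apply ((C : L →+* L[X]).comp (ι.comp C)), map_sum]
      exact Finset.sum_congr rfl fun i _ => by rw [frob_apply, hfr]
    have hc (i : ℕ) : (facL ι d ^ (Nat.card F - 1))⁻¹ *
        ((-1) ^ i * facL ι d / (facL ι (d - i) ^ Nat.card F ^ i * facD ι i)) ^ Nat.card F =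
        (-1) ^ i * facL ι d * brk ι (i + 1) /
          (facL ι (d - i) ^ Nat.card F ^ (i + 1) * facD ι (i + 1)) := by
      have h1 : ((-1 : L) ^ i) ^ Nat.card F = (-1) ^ i := by
        rw [← pow_mul, mul_comm, pow_mul, neg_pow_card ι, one_pow]
      rw [div_pow, mul_pow, mul_pow, h1, pow_card_eq_mul (F := F) (facL ι d), facD_succ]
      have := brk_ne_zero hι i
      have := hL d
      have := hL (d - i)
      have := hD i
      have hA := pow_ne_zero (Nat.card F - 1) (hL d)
      generalize facL ι d ^ (Nat.card F - 1) = A at hA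
      rw [← pow_mul, ← pow_succ]
      field_simp
    rw [addPoly, hpow, Finset.mul_sum]
    simp only [← mul_assoc, ← C_mul, hc]
    rw [ih, Finset.sum_range_succ' _ d, Finset.sum_range_succ _ d, Finset.sum_range_succ' _ (d + 1),
      Finset.sum_range_succ _ d, add_sub_add_comm, ← Finset.sum_sub_distrib]
    have h0 : ((-1) ^ 0 * facL ι d / (facL ι (d - 0) ^ Nat.card F ^ 0 * facD ι 0)) =
        ((-1) ^ 0 * facL ι (d + 1) / (facL ι (d + 1 - 0) ^ Nat.card F ^ 0 * facD ι 0)) := by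
      simp [hL, facD]
    rw [h0]
    have hmid : ∀ i ∈ Finset.range d,
        C ((-1) ^ (i + 1) * facL ι d / (facL ι (d - (i + 1)) ^ Nat.card F ^ (i + 1) *
          facD ι (i + 1))) * X ^ Nat.card F ^ (i + 1) -
        C ((-1) ^ i * facL ι d * brk ι (i + 1) /
          (facL ι (d - i) ^ Nat.card F ^ (i + 1) * facD ι (i + 1))) * X ^ Nat.card F ^ (i + 1) =
        C ((-1) ^ (i + 1) * facL ι (d + 1) / (facL ι (d + 1 - (i + 1)) ^ Nat.card F ^ (i + 1) *
          facD ι (i + 1))) * X ^ Nat.card F ^ (i + 1) := by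
      intro i hi
      -- After clearing denominators, the identity for the middle coefficients is `[m+1]^(q^(i+1)) +
      -- [i+1] = [d+1]`, which is `brk_pow_pow`.
      obtain ⟨m, rfl⟩ : ∃ m, d = m + 1 + i := ⟨d - 1 - i, by grind⟩
      rw [← sub_mul, ← C_sub]
      congr 2
      rw [show m + 1 + i - (i + 1) = m by omega, show m + 1 + i - i = m + 1 by omega,
        show m + 1 + i + 1 - (i + 1) = m + 1 by omega, facL_succ ι (m + 1 + i), facL_succ ι m,
        mul_pow, brk_pow_pow]
      have hb : brk ι (m + 1 + (i + 1)) - brk ι (i + 1) ≠ 0 := by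
        rw [← brk_pow_pow]; exact pow_ne_zero _ (brk_ne_zero hι m)
      have := hL m
      have := hD (i + 1)
      rw [show m + 1 + i + 1 = m + 1 + (i + 1) by omega]
      field_simp
      ring
    rw [Finset.sum_congr rfl hmid]
    have hlast : (-1) ^ (d + 1) * facL ι (d + 1) / (facL ι (d + 1 - (d + 1)) ^ Nat.card F ^ (d + 1) *
          facD ι (d + 1)) = -((-1) ^ d * facL ι d * brk ι (d + 1) /
          (facL ι (d - d) ^ Nat.card F ^ (d + 1) * facD ι (d + 1))) := by
      rw [facL_succ, Nat.sub_self, Nat.sub_self]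
      ring
    rw [hlast, C_neg]
    ring

end CarlitzPolynomials

/-! ### The Carlitz period and the limit of the coefficients -/

section Period

variable {F : Type*} [Field F] [Finite F]

variable (F) in
lemma one_lt_card_real : (1 : ℝ) < Nat.card F := by exact_mod_cast Finite.one_lt_card

lemma theta_ne_zero : theta F ≠ 0 :=
  norm_pos_iff.1 (norm_theta (F := F) ▸ zero_lt_one.trans (one_lt_card_real F))

lemma norm_one_sub_of_norm_lt_one {L : Type*} [NormedField L] [IsUltrametricDist L] {x : L}
    (hx : ‖x‖ < 1) : ‖1 - x‖ = 1 := by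
  rw [sub_eq_add_neg, IsUltrametricDist.norm_add_eq_max_of_norm_ne_norm] <;>
    simp [hx.le, hx.ne']

lemma norm_brk (i : ℕ) : ‖brk (ofA F) (i + 1)‖ = (Nat.card F : ℝ) ^ Nat.card F ^ (i + 1) := by
  have h1 : 1 < Nat.card F ^ (i + 1) := Nat.one_lt_pow (by simp) Finite.one_lt_card
  have h2 : ‖theta F‖ < ‖theta F ^ Nat.card F ^ (i + 1)‖ := by
    rw [norm_pow, norm_theta]
    exact lt_self_pow₀ (one_lt_card_real F) h1
  change ‖theta F ^ Nat.card F ^ (i + 1) - theta F‖ = _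
  rw [sub_eq_add_neg, IsUltrametricDist.norm_add_eq_max_of_norm_ne_norm (by simpa using h2.ne'),
    norm_neg, max_eq_left h2.le, norm_pow, norm_theta]

lemma norm_carlitzD (i : ℕ) :
    ‖carlitzD F i‖ = (Nat.card F : ℝ) ^ (i * Nat.card F ^ i) := by
  change ‖facD (ofA F) i‖ = _
  induction i with
  | zero => simp [facD]
  | succ i ih =>
    rw [facD_succ, norm_mul, norm_pow, ih, norm_brk, ← pow_mul, ← pow_add]
    congr 1
    ring

lemma carlitzD_ne_zero (i : ℕ) : carlitzD F i ≠ 0 := facD_ne_zero ofA_injective i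

variable (F) in
/-- The partial products of the infinite product in the definition of the Carlitz period. -/
def periodProd (d : ℕ) : CInfty F :=
  ∏ j ∈ Finset.range d, (1 - theta F ^ (1 - (Nat.card F : ℤ) ^ (j + 1)))

lemma norm_theta_zpow_le (j : ℕ) :
    ‖theta F ^ (1 - (Nat.card F : ℤ) ^ (j + 1))‖ ≤ ((Nat.card F : ℝ)⁻¹) ^ (j + 1) := by
  rw [norm_zpow, norm_theta, inv_pow, ← zpow_natCast, ← zpow_neg]
  refine zpow_le_zpow_right₀ (one_lt_card_real F).le ?_
  have : j + 1 < Nat.card F ^ (j + 1) := Nat.lt_pow_self Finite.one_lt_card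
  push_cast
  have : ((j + 1 : ℕ) : ℤ) < (Nat.card F : ℤ) ^ (j + 1) := by exact_mod_cast this
  push_cast at this
  omega

lemma norm_theta_zpow_lt_one (j : ℕ) :
    ‖theta F ^ (1 - (Nat.card F : ℤ) ^ (j + 1))‖ < 1 :=
  (norm_theta_zpow_le j).trans_lt
    (pow_lt_one₀ (by positivity) (inv_lt_one_of_one_lt₀ (one_lt_card_real F)) (by simp))

lemma norm_periodProd (d : ℕ) : ‖periodProd F d‖ = 1 := by
  rw [periodProd, norm_prod]
  exact Finset.prod_eq_one fun j _ => norm_one_sub_of_norm_lt_one (norm_theta_zpow_lt_one j)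

variable (F) in
/-- The infinite product in the definition of the Carlitz period. -/
def periodProdInv : CInfty F :=
  ∏' i : ℕ, (1 - theta F ^ (1 - (Nat.card F : ℤ) ^ (i + 1)))⁻¹

lemma tendsto_periodProd_inv :
    Tendsto (fun d => (periodProd F d)⁻¹) atTop (𝓝 (periodProdInv F)) := by
  have h1 (j : ℕ) := norm_one_sub_of_norm_lt_one (norm_theta_zpow_lt_one (F := F) j)
  have h : Multipliable fun i : ℕ => (1 - theta F ^ (1 - (Nat.card F : ℤ) ^ (i + 1)))⁻¹ := by
    have h2 (i : ℕ) : (1 - theta F ^ (1 - (Nat.card F : ℤ) ^ (i + 1)))⁻¹ =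
        1 + theta F ^ (1 - (Nat.card F : ℤ) ^ (i + 1)) *
          (1 - theta F ^ (1 - (Nat.card F : ℤ) ^ (i + 1)))⁻¹ := by
      have : 1 - theta F ^ (1 - (Nat.card F : ℤ) ^ (i + 1)) ≠ 0 :=
        norm_ne_zero_iff.1 (by rw [h1]; exact one_ne_zero)
      field_simp
      ring
    rw [funext h2]
    refine multipliable_one_add_of_summable ?_
    refine Summable.of_nonneg_of_le (fun _ => norm_nonneg _) (fun j => ?_)
      ((summable_nat_add_iff 1).2 (summable_geometric_of_lt_one (r := (Nat.card F : ℝ)⁻¹)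
        (by positivity) (inv_lt_one_of_one_lt₀ (one_lt_card_real F))))
    rw [norm_mul, norm_inv, h1, inv_one, mul_one]
    exact norm_theta_zpow_le j
  simpa only [periodProd, periodProdInv, Finset.prod_inv_distrib] using
    h.hasProd.tendsto_prod_nat

lemma norm_periodProdInv : ‖periodProdInv F‖ = 1 := by
  refine tendsto_nhds_unique tendsto_periodProd_inv.norm ?_
  simp [norm_inv, norm_periodProd]

lemma periodProdInv_ne_zero : periodProdInv F ≠ 0 :=
  norm_ne_zero_iff.1 (by rw [norm_periodProdInv]; exact one_ne_zero)

lemma periodProd_ne_zero (d : ℕ) : periodProd F d ≠ 0 :=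
  norm_ne_zero_iff.1 (by rw [norm_periodProd]; exact one_ne_zero)

lemma tendsto_periodProd_mul :
    Tendsto (fun d => periodProd F d * periodProdInv F) atTop (𝓝 1) := by
  have := (tendsto_periodProd_inv (F := F)).inv₀ periodProdInv_ne_zero
  simpa [periodProdInv_ne_zero] using this.mul_const (periodProdInv F)

lemma facL_eq_theta_pow_mul (d : ℕ) :
    facL (ofA F) d = theta F ^ (∑ j ∈ Finset.range d, Nat.card F ^ (j + 1)) * periodProd F d := by
  rw [facL, periodProd, ← Finset.prod_pow_eq_pow_sum, ← Finset.prod_mul_distrib]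
  refine Finset.prod_congr rfl fun j _ => ?_
  rw [mul_sub, mul_one, ← zpow_natCast, ← zpow_add₀ theta_ne_zero]
  push_cast
  rw [add_sub_cancel, zpow_one, ← Nat.cast_pow, zpow_natCast]
  rfl

variable {ξ : CInfty F}

lemma carlitzPeriod_eq (ξ : CInfty F) : carlitzPeriod ξ = theta F * ξ * periodProdInv F := rfl

lemma root_ne_zero (hξ : ξ ^ (Nat.card F - 1) = -theta F) : ξ ≠ 0 := by
  rintro rfl
  rw [zero_pow (Nat.sub_pos_of_lt Finite.one_lt_card).ne', zero_eq_neg] at hξ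
  exact theta_ne_zero hξ

lemma carlitzPeriod_ne_zero (hξ : ξ ^ (Nat.card F - 1) = -theta F) : carlitzPeriod ξ ≠ 0 :=
  mul_ne_zero (mul_ne_zero theta_ne_zero (root_ne_zero hξ)) periodProdInv_ne_zero

/-- Iteration of `(θξ)^q = -θ^q (θξ)`, which is `ξ^q = -θξ`. -/
lemma theta_mul_root_pow (hξ : ξ ^ (Nat.card F - 1) = -theta F) (i : ℕ) :
    (theta F * ξ) ^ Nat.card F ^ i =
      (-1) ^ i * theta F ^ (∑ j ∈ Finset.range i, Nat.card F ^ (j + 1)) * (theta F * ξ) := by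
  induction i with
  | zero => simp
  | succ i ih =>
    have h1 : ((-1 : CInfty F) ^ i) ^ Nat.card F = (-1) ^ i := by
      rw [← pow_mul, mul_comm, pow_mul, neg_pow_card (ofA F), one_pow]
    rw [pow_succ, pow_mul, ih, mul_pow, mul_pow, mul_pow, h1, pow_card_eq_mul (F := F) ξ, hξ,
      Finset.sum_range_succ', ← pow_mul, Finset.sum_mul]
    simp only [← pow_succ]
    ring

/-- The quotient of the coefficients of `X ^ (q ^ i)` in the `d`-th partial product and in the
full product for the Carlitz exponential. -/
def coeffRatio (F : Type*) [Field F] [Finite F] (d i : ℕ) : CInfty F :=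
  periodProd F d * periodProdInv F / (periodProd F (d - i) * periodProdInv F) ^ Nat.card F ^ i

lemma norm_coeffRatio (d i : ℕ) : ‖coeffRatio F d i‖ = 1 := by
  simp [coeffRatio, norm_periodProd, norm_periodProdInv]

lemma tendsto_coeffRatio (i : ℕ) : Tendsto (fun d => coeffRatio F d i) atTop (𝓝 1) := by
  have h := tendsto_periodProd_mul (F := F)
  have h2 := h.div ((h.comp (tendsto_sub_atTop_nat i)).pow (Nat.card F ^ i)) (by simp)
  rw [one_pow, div_one] at h2
  exact h2

/-- The power of `θ` left in `L_d / L_{d-i}^(q^i)` is `q + ⋯ + q^i`, and with the sign it is exactly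
the factor in `(θξ)^(q^i)`. What remains is a quotient of partial products, of norm `1` and tending
to `1`. -/
lemma carlitzPeriod_mul_coeff (hξ : ξ ^ (Nat.card F - 1) = -theta F) {d i : ℕ} (hi : i ≤ d) :
    carlitzPeriod ξ * ((-1) ^ i * facL (ofA F) d /
      (facL (ofA F) (d - i) ^ Nat.card F ^ i * facD (ofA F) i)) =
      carlitzPeriod ξ ^ Nat.card F ^ i / carlitzD F i * coeffRatio F d i := by
  obtain ⟨m, rfl⟩ := Nat.exists_eq_add_of_le hi
  have hs : ∑ j ∈ Finset.range (i + m), Nat.card F ^ (j + 1) =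
      ∑ j ∈ Finset.range i, Nat.card F ^ (j + 1) +
        (∑ j ∈ Finset.range m, Nat.card F ^ (j + 1)) * Nat.card F ^ i := by
    rw [Finset.sum_range_add, Finset.sum_mul]
    congr 1
    exact Finset.sum_congr rfl fun j _ => by ring
  rw [Nat.add_sub_cancel_left, facL_eq_theta_pow_mul, facL_eq_theta_pow_mul, carlitzPeriod_eq,
    mul_pow (theta F * ξ), theta_mul_root_pow hξ, hs, coeffRatio, Nat.add_sub_cancel_left,
    show facD (ofA F) i = carlitzD F i from rfl]
  have h1 := theta_ne_zero (F := F)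
  have h2 := root_ne_zero hξ
  have h3 := periodProdInv_ne_zero (F := F)
  have h4 := periodProd_ne_zero (F := F) m
  have h5 := carlitzD_ne_zero (F := F) i
  rw [mul_pow, mul_pow, ← pow_mul, pow_add]
  field_simp

end Period

/-! ### Convergence to the Carlitz exponential, its norm and its zeros -/

section Exponential

variable {F : Type*} [Field F] [Finite F]

variable (F) in
lemma summable_norm_bound (R : ℝ) (hR : 0 ≤ R) :
    Summable fun i : ℕ => R ^ Nat.card F ^ i / (Nat.card F : ℝ) ^ (i * Nat.card F ^ i) := by
  have hq := one_lt_card_real F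
  have h1 : ∀ᶠ i : ℕ in atTop, R / (Nat.card F : ℝ) ^ i ≤ 1 / 2 := by
    have : Tendsto (fun i : ℕ => R / (Nat.card F : ℝ) ^ i) atTop (𝓝 0) :=
      tendsto_const_nhds.div_atTop (tendsto_pow_atTop_atTop_of_one_lt hq)
    exact (this.eventually_lt_const (by norm_num : (0 : ℝ) < 1 / 2)).mono fun _ => le_of_lt
  refine Summable.of_norm_bounded_eventually_nat (g := fun i => (1 / 2 : ℝ) ^ i)
    (summable_geometric_of_lt_one (by norm_num) (by norm_num)) ?_
  filter_upwards [h1] with i hi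
  -- The term is `(R / q^i)^(q^i)`, whose base is eventually at most `1/2` and whose exponent is at
  -- least `i`.
  rw [pow_mul, ← div_pow, Real.norm_of_nonneg (by positivity)]
  exact (pow_le_pow_left₀ (by positivity) hi _).trans
    (pow_le_pow_of_le_one (by norm_num) (by norm_num) (Nat.lt_pow_self Finite.one_lt_card).le)

lemma norm_exp_term (w : CInfty F) (i : ℕ) : ‖w ^ Nat.card F ^ i / carlitzD F i‖ =
    ‖w‖ ^ Nat.card F ^ i / (Nat.card F : ℝ) ^ (i * Nat.card F ^ i) := by
  rw [norm_div, norm_pow, norm_carlitzD]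

lemma hasSum_carlitzExp (w : CInfty F) :
    HasSum (fun i : ℕ => w ^ Nat.card F ^ i / carlitzD F i) (carlitzExp w) := by
  refine (Summable.of_norm ?_).hasSum
  simpa only [norm_exp_term] using summable_norm_bound F ‖w‖ (norm_nonneg w)

variable {ξ : CInfty F}

lemma carlitzPeriod_mul_eval_addPoly (hξ : ξ ^ (Nat.card F - 1) = -theta F) (d : ℕ)
    (z : CInfty F) : carlitzPeriod ξ * (addPoly (ofA F) d).eval z =
      ∑ i ∈ Finset.range (d + 1),
        (carlitzPeriod ξ * z) ^ Nat.card F ^ i / carlitzD F i * coeffRatio F d i := by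
  rw [addPoly_eq_sum ofA_injective, eval_finsetSum, Finset.mul_sum]
  refine Finset.sum_congr rfl fun i hi => ?_
  rw [eval_C_mul, eval_pow, eval_X, ← mul_assoc,
    carlitzPeriod_mul_coeff hξ (Nat.lt_succ_iff.1 (Finset.mem_range.1 hi)), mul_pow]
  ring

/-- Dominated convergence applies because the ratios have norm `1`: the terms of the series for
`e_C` bound those at every level `d`. -/
lemma tendsto_addPoly (hξ : ξ ^ (Nat.card F - 1) = -theta F) (z : CInfty F) :
    Tendsto (fun d => carlitzPeriod ξ * (addPoly (ofA F) d).eval z) atTop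
      (𝓝 (carlitzExp (carlitzPeriod ξ * z))) := by
  set w := carlitzPeriod ξ * z
  let f (d i : ℕ) : CInfty F :=
    if i ≤ d then w ^ Nat.card F ^ i / carlitzD F i * coeffRatio F d i else 0
  have hf (d : ℕ) : carlitzPeriod ξ * (addPoly (ofA F) d).eval z = ∑' i, f d i := by
    rw [carlitzPeriod_mul_eval_addPoly hξ, tsum_eq_sum (s := Finset.range (d + 1))]
    · exact Finset.sum_congr rfl fun i hi =>
        (if_pos (Nat.lt_succ_iff.1 (Finset.mem_range.1 hi))).symm
    · exact fun i hi => if_neg (by simpa using hi)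
  simp only [hf]
  refine tendsto_tsum_of_dominated_convergence (summable_norm_bound F ‖w‖ (norm_nonneg w))
    (fun i => ?_) (Eventually.of_forall fun d i => ?_)
  · have h1 : (fun d => w ^ Nat.card F ^ i / carlitzD F i * coeffRatio F d i) =ᶠ[atTop]
        fun d => f d i := by
      filter_upwards [eventually_ge_atTop i] with d hd
      exact (if_pos hd).symm
    refine Tendsto.congr' h1 ?_
    simpa using (tendsto_coeffRatio i).const_mul (w ^ Nat.card F ^ i / carlitzD F i)
  · dsimp only [f]
    split_ifs
    · rw [norm_mul, norm_coeffRatio, mul_one, norm_exp_term]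
    · rw [norm_zero]; positivity

lemma carlitzExp_add (hξ : ξ ^ (Nat.card F - 1) = -theta F) (x y : CInfty F) :
    carlitzExp (carlitzPeriod ξ * (x + y)) =
      carlitzExp (carlitzPeriod ξ * x) + carlitzExp (carlitzPeriod ξ * y) := by
  refine tendsto_nhds_unique (tendsto_addPoly hξ (x + y)) ?_
  simpa only [eval_addPoly_add, mul_add] using (tendsto_addPoly hξ x).add (tendsto_addPoly hξ y)

lemma norm_le_norm_ofA {a : F[X]} {N : ℕ} (ha : a ∉ polysLT F N) :
    (Nat.card F : ℝ) ^ N ≤ ‖ofA F a‖ := by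
  rw [mem_polysLT, not_lt] at ha
  have h0 : a ≠ 0 := by rintro rfl; simp at ha
  rw [norm_ofA h0]
  exact pow_le_pow_right₀ (one_lt_card_real F).le (le_natDegree_of_coe_le_degree ha)

-- A factor `1 - z/a` with `|a| ≥ q^N > |z|` has norm `1`.
open Classical in
lemma norm_eval_addPoly {z : CInfty F} {N d : ℕ} (hz : ‖z‖ < (Nat.card F : ℝ) ^ N) (hd : N ≤ d) :
    ‖(addPoly (ofA F) d).eval z‖ = ‖(addPoly (ofA F) N).eval z‖ := by
  rw [eval_addPoly_eq_prod ofA_injective, eval_addPoly_eq_prod ofA_injective, norm_mul, norm_mul,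
    norm_prod, norm_prod]
  congr 1
  symm
  refine Finset.prod_subset (fun a ha => ?_) fun a ha h => ?_
  · rw [Finset.mem_erase, mem_polysLT] at ha ⊢
    exact ⟨ha.1, ha.2.trans_le (by exact_mod_cast hd)⟩
  · rw [Finset.mem_erase, not_and] at h
    have h1 := norm_le_norm_ofA (h (Finset.ne_of_mem_erase ha))
    refine norm_one_sub_of_norm_lt_one ?_
    have h2 : 0 < (Nat.card F : ℝ) ^ N := pow_pos (zero_lt_one.trans (one_lt_card_real F)) _
    rw [norm_div, div_lt_one (h2.trans_le h1)]
    exact hz.trans_le h1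

/-- The norms along the limit are eventually constant, so a finite product computes the norm of
`e_C(π̃z)` exactly. Nonvanishing off `A` and lower bounds on affinoids follow. -/
lemma norm_carlitzExp (hξ : ξ ^ (Nat.card F - 1) = -theta F) {z : CInfty F} {N : ℕ}
    (hz : ‖z‖ < (Nat.card F : ℝ) ^ N) :
    ‖carlitzExp (carlitzPeriod ξ * z)‖ =
      ‖carlitzPeriod ξ‖ * ‖(addPoly (ofA F) N).eval z‖ := by
  refine tendsto_nhds_unique (tendsto_addPoly hξ z).norm ?_
  refine tendsto_const_nhds.congr' ?_
  filter_upwards [eventually_ge_atTop N] with d hd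
  rw [norm_mul, norm_eval_addPoly hz hd]

lemma exists_norm_lt_card_pow (z : CInfty F) : ∃ N : ℕ, ‖z‖ < (Nat.card F : ℝ) ^ N :=
  pow_unbounded_of_one_lt _ (one_lt_card_real F)

lemma eval_addPoly_ne_zero {z : CInfty F} (hz : ∀ a, z ≠ ofA F a) (d : ℕ) :
    (addPoly (ofA F) d).eval z ≠ 0 := by
  classical
  rw [eval_addPoly_eq_prod ofA_injective]
  refine mul_ne_zero (by simpa using hz 0) (Finset.prod_ne_zero_iff.2 fun a ha => ?_)
  have h : ofA F a ≠ 0 := (map_ne_zero_iff _ ofA_injective).2 (Finset.ne_of_mem_erase ha)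
  rw [sub_ne_zero, ne_comm, Ne, div_eq_one_iff_eq h]
  exact hz a

lemma carlitzExp_ne_zero (hξ : ξ ^ (Nat.card F - 1) = -theta F) {z : CInfty F}
    (hz : ∀ a, z ≠ ofA F a) : carlitzExp (carlitzPeriod ξ * z) ≠ 0 := by
  obtain ⟨N, hN⟩ := exists_norm_lt_card_pow z
  rw [← norm_ne_zero_iff, norm_carlitzExp hξ hN, ← norm_mul, norm_ne_zero_iff]
  exact mul_ne_zero (carlitzPeriod_ne_zero hξ) (eval_addPoly_ne_zero hz N)

end Exponential

/-! ### Unconditional convergence of nonarchimedean products -/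

section InfiniteProduct

/-- In a nonarchimedean field, a product of factors tending to `1` that converges along an
exhausting sequence of finite sets converges unconditionally. -/
lemma hasProd_of_tendsto_prod {L I : Type*} [NormedField L] [IsUltrametricDist L] {a : I → L}
    (ha : Tendsto a cofinite (𝓝 0)) {S : ℕ → Finset I} (hS : Tendsto S atTop atTop) {P : L}
    (hP : Tendsto (fun d => ∏ i ∈ S d, (1 + a i)) atTop (𝓝 P)) :
    HasProd (fun i => 1 + a i) P := by
  classical
  -- By the ultrametric inequality the error does not grow with the number of factors.
  have key (ε : ℝ) (hε : 0 < ε) (hε1 : ε ≤ 1) (t : Finset I) (ht : ∀ i ∈ t, ‖a i‖ ≤ ε) :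
      ‖∏ i ∈ t, (1 + a i) - 1‖ ≤ ε := by
    induction t using Finset.induction_on with
    | empty => simpa using hε.le
    | insert i t hi ih =>
      rw [Finset.prod_insert hi]
      have h1 : (1 + a i) * ∏ i ∈ t, (1 + a i) - 1 =
          (∏ i ∈ t, (1 + a i) - 1) * (1 + a i) + a i := by ring
      have h2 := ht i (Finset.mem_insert_self i t)
      have h3 : ‖1 + a i‖ ≤ 1 := (IsUltrametricDist.norm_add_le_max _ _).trans (by
        simpa using h2.trans hε1)
      rw [h1]
      refine (IsUltrametricDist.norm_add_le_max _ _).trans (max_le ?_ h2)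
      rw [norm_mul]
      exact (mul_le_of_le_one_right (norm_nonneg _) h3).trans
        (ih fun j hj => ht j (Finset.mem_insert_of_mem hj))
  rw [HasProd, SummationFilter.unconditional_filter, Metric.tendsto_atTop]
  intro ε hε
  set B : ℝ := ‖P‖ + 1
  have hB : 0 < B := by positivity
  -- `B` will bound the product over `S d`, so a relative error `δ` costs at most `ε / 2`; `key`
  -- needs `δ ≤ 1`.
  set δ : ℝ := min 1 (ε / (2 * B))
  have hδ : 0 < δ := by positivity
  -- Once `S d` contains this finite set, every further factor is within `δ` of `1`.
  have hfin : {i | ¬‖a i‖ ≤ δ}.Finite := by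
    have := (ha.norm.eventually_lt_const (by simpa using hδ)).mono fun _ h => le_of_lt h
    exact this
  obtain ⟨d, hd1, hd2, hd3⟩ := ((hS.eventually_ge_atTop hfin.toFinset).and
    (((Metric.tendsto_nhds.1 hP (ε / 2) (by positivity))).and
      (hP.norm.eventually_lt_const (show ‖P‖ < B by simp [B])))).exists
  refine ⟨S d, fun t ht => ?_⟩
  have h1 : ∏ i ∈ t, (1 + a i) - ∏ i ∈ S d, (1 + a i) =
      (∏ i ∈ S d, (1 + a i)) * (∏ i ∈ t \ S d, (1 + a i) - 1) := by
    rw [← Finset.prod_sdiff (show S d ⊆ t from ht)]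
    ring
  have h2 : ‖∏ i ∈ t \ S d, (1 + a i) - 1‖ ≤ δ := key δ hδ (min_le_left _ _) _ fun i hi => by
    by_contra h
    exact (Finset.mem_sdiff.1 hi).2 (hd1 (hfin.mem_toFinset.2 h))
  calc dist (∏ i ∈ t, (1 + a i)) P
      ≤ dist (∏ i ∈ t, (1 + a i)) (∏ i ∈ S d, (1 + a i)) + dist (∏ i ∈ S d, (1 + a i)) P :=
        dist_triangle _ _ _
    _ < ε / 2 + ε / 2 := by
        refine add_lt_add_of_le_of_lt ?_ hd2
        rw [dist_eq_norm, h1, norm_mul]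
        calc _ ≤ B * δ := mul_le_mul hd3.le h2 (norm_nonneg _) hB.le
          _ ≤ B * (ε / (2 * B)) := mul_le_mul_of_nonneg_left (min_le_right _ _) hB.le
          _ = ε / 2 := by field_simp
    _ = ε := add_halves ε

end InfiniteProduct

/-! ### The lattice `Λ_C` and the product formula for `e_C` -/

section Lattice

variable {F : Type*} [Field F] [Finite F]

lemma tendsto_polysLT : Tendsto (polysLT F) atTop atTop := by
  refine Filter.tendsto_atTop_finset_of_monotone (fun d e hde a ha => ?_) fun a => ?_
  · rw [mem_polysLT] at ha ⊢
    exact ha.trans_le (by exact_mod_cast hde)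
  · refine ⟨a.natDegree + 1, mem_polysLT.2 ?_⟩
    exact degree_le_natDegree.trans_lt (by exact_mod_cast Nat.lt_succ_self _)

lemma tendsto_norm_ofA : Tendsto (fun a => ‖ofA F a‖) cofinite atTop := by
  refine tendsto_atTop.2 fun R => ?_
  obtain ⟨N, hN⟩ := pow_unbounded_of_one_lt R (one_lt_card_real F)
  refine (polysLT F N).finite_toSet.subset fun a ha => ?_
  by_contra h
  exact ha (hN.le.trans (norm_le_norm_ofA h))

lemma tendsto_inv_ofA : Tendsto (fun a => (ofA F a)⁻¹) cofinite (𝓝 0) :=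
  tendsto_inv₀_cobounded.comp (tendsto_norm_atTop_iff_cobounded.1 tendsto_norm_ofA)

lemma tendsto_inv_sub_ofA (z : CInfty F) :
    Tendsto (fun a => (z - ofA F a)⁻¹) cofinite (𝓝 0) := by
  refine tendsto_inv₀_cobounded.comp (tendsto_norm_atTop_iff_cobounded.1 ?_)
  refine tendsto_atTop_mono (fun a => ?_)
    (tendsto_atTop_add_const_right _ (-‖z‖) tendsto_norm_ofA)
  have := norm_sub_norm_le (ofA F a) z
  rw [norm_sub_rev] at this
  linarith

variable {ξ : CInfty F}

/-- The lattice `Λ_C` is parametrized by `F[θ]`. -/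
def latticeEquiv (hξ : ξ ^ (Nat.card F - 1) = -theta F) : F[X] ≃ carlitzLattice ξ :=
  Equiv.ofInjective _ fun _ _ h =>
    ofA_injective (mul_right_cancel₀ (carlitzPeriod_ne_zero hξ) h)

lemma latticeEquiv_apply (hξ : ξ ^ (Nat.card F - 1) = -theta F) (a : F[X]) :
    (latticeEquiv hξ a : CInfty F) = ofA F a * carlitzPeriod ξ := rfl

/-- The nonzero elements of `Λ_C` are parametrized by the nonzero elements of `F[θ]`. -/
def nonzeroLatticeEquiv (hξ : ξ ^ (Nat.card F - 1) = -theta F) :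
    {a : F[X] // a ≠ 0} ≃ {l : CInfty F // l ∈ carlitzLattice ξ ∧ l ≠ 0} :=
  ((latticeEquiv hξ).subtypeEquiv (q := fun l : carlitzLattice ξ => (l : CInfty F) ≠ 0) fun a => by
    simp [latticeEquiv_apply, carlitzPeriod_ne_zero hξ,
      map_eq_zero_iff (ofA F) ofA_injective]).trans
    (Equiv.subtypeSubtypeEquivSubtypeInter (· ∈ carlitzLattice ξ) (· ≠ 0))

lemma nonzeroLatticeEquiv_apply (hξ : ξ ^ (Nat.card F - 1) = -theta F) (a : {a : F[X] // a ≠ 0}) :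
    (nonzeroLatticeEquiv hξ a : CInfty F) = ofA F a * carlitzPeriod ξ := rfl

/-- The product expansion of the Carlitz exponential. -/
lemma latticeExp_carlitzLattice (hξ : ξ ^ (Nat.card F - 1) = -theta F) (w : CInfty F) :
    latticeExp (carlitzLattice ξ) w = carlitzExp w := by
  classical
  have hπ := carlitzPeriod_ne_zero hξ
  obtain ⟨z, rfl⟩ : ∃ z, carlitzPeriod ξ * z = w := ⟨w / carlitzPeriod ξ, by field_simp⟩
  rcases eq_or_ne z 0 with rfl | hz
  -- Additivity gives `e_C(0) = 0`; the division by `π̃z` below needs `z ≠ 0`.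
  · have := carlitzExp_add hξ 0 0
    simp only [add_zero, mul_zero, left_eq_add] at this
    rw [latticeExp, mul_zero, zero_mul, this]
  have h : HasProd (fun a : {a : F[X] // a ≠ 0} => 1 + -(z / ofA F a))
      (carlitzExp (carlitzPeriod ξ * z) / (carlitzPeriod ξ * z)) := by
    refine hasProd_of_tendsto_prod (S := fun d => (polysLT F d).subtype (· ≠ 0)) ?_ ?_ ?_
    · have := (tendsto_inv_ofA (F := F)).const_mul (-z)
      rw [mul_zero] at this
      have := this.comp (Subtype.val_injective (p := fun a : F[X] => a ≠ 0)).tendsto_cofinite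
      refine this.congr fun a => ?_
      simp [div_eq_mul_inv]
    · refine tendsto_atTop.2 fun t => ?_
      filter_upwards [tendsto_polysLT.eventually_ge_atTop (t.map (.subtype _))] with d hd a ha
      exact Finset.mem_subtype.2 (hd (Finset.mem_map_of_mem _ ha))
    · have := (tendsto_addPoly hξ z).div_const (carlitzPeriod ξ * z)
      refine this.congr fun d => ?_
      rw [mul_div_mul_left _ _ hπ, eval_addPoly_eq_prod ofA_injective,
        mul_div_cancel_left₀ _ hz]
      rw [Finset.prod_subtype_eq_prod_filter (p := fun a => a ≠ 0)
        (f := fun a => 1 + -(z / ofA F a)), Finset.filter_ne']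
      exact Finset.prod_congr rfl fun a _ => sub_eq_add_neg _ _
  have h2 : HasProd (fun l : {l : CInfty F // l ∈ carlitzLattice ξ ∧ l ≠ 0} =>
      1 - carlitzPeriod ξ * z / l.1) (carlitzExp (carlitzPeriod ξ * z) / (carlitzPeriod ξ * z)) := by
    rw [← (nonzeroLatticeEquiv hξ).hasProd_iff]
    convert! h using 2 with a
    rw [Function.comp_apply, nonzeroLatticeEquiv_apply, mul_comm (ofA F _),
      mul_div_mul_left _ _ hπ, sub_eq_add_neg]
  rw [latticeExp, h2.tprod_eq, mul_div_cancel₀ _ (mul_ne_zero hπ hz)]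

end Lattice

/-! ### Powers of the reciprocal of `e - E(X)` -/

section PowerSeries

open Finset in
-- Pascal's rule: truncations of `(1 - K)^(-n-1)` and `(1 - K)^(-n)` differ by the factor `1 - K` up
-- to one top term.
lemma one_sub_mul_sum_multichoose {R : Type*} [CommRing R] (K : R) (n N : ℕ) :
    (1 - K) * ∑ j ∈ range (N + 1), (Nat.multichoose (n + 1) j : R) * K ^ j =
      ∑ j ∈ range (N + 1), (Nat.multichoose n j : R) * K ^ j -
        (Nat.multichoose (n + 1) N : R) * K ^ (N + 1) := by
  induction N with
  | zero => simp
  | succ N ih =>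
    rw [sum_range_succ, mul_add, ih, sum_range_succ _ (N + 1), Nat.multichoose_succ_succ]
    push_cast
    ring

/-- The coefficients of the powers of `1 / (e - E)` for a power series `E` without constant
term. -/
lemma coeff_pow_of_mul_C_sub_eq_one {L : Type*} [Field L] {E Φ : PowerSeries L} {e : L} (he : e ≠ 0)
    (hE : PowerSeries.constantCoeff E = 0) (h : Φ * (PowerSeries.C e - E) = 1) (n r : ℕ) :
    PowerSeries.coeff r (Φ ^ n) = ∑ j ∈ Finset.range (r + 1),
      (Nat.multichoose n j : L) * e⁻¹ ^ (n + j) * PowerSeries.coeff r (E ^ j) := by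
  set K : PowerSeries L := PowerSeries.C e⁻¹ * E with hK
  set Ψ : PowerSeries L := Φ * PowerSeries.C e
  have hee : PowerSeries.C e * PowerSeries.C e⁻¹ = (1 : PowerSeries L) := by
    rw [← map_mul, mul_inv_cancel₀ he, map_one]
  have hΨ : Ψ * (1 - K) = 1 := by
    rw [hK]
    linear_combination h - Φ * E * hee
  have hXK : (PowerSeries.X : PowerSeries L) ^ (r + 1) ∣ K ^ (r + 1) :=
    pow_dvd_pow_of_dvd (PowerSeries.X_dvd_iff.2 (by simp [hK, hE])) _
  -- Since `X` divides `K`, the expansion of `(1 - K)^(-n)` can be truncated modulo `X^(r+1)`, and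
  -- no infinite sum of series is needed.
  have key : (PowerSeries.X : PowerSeries L) ^ (r + 1) ∣
      Ψ ^ n - ∑ j ∈ Finset.range (r + 1), (Nat.multichoose n j : PowerSeries L) * K ^ j := by
    induction n with
    | zero => simp [Finset.sum_range_succ']
    | succ n ih =>
      have := one_sub_mul_sum_multichoose K n r
      have h2 : Ψ ^ (n + 1) - ∑ j ∈ Finset.range (r + 1), (Nat.multichoose (n + 1) j : PowerSeries L) * K ^ j
          = Ψ * (Ψ ^ n - ∑ j ∈ Finset.range (r + 1), (Nat.multichoose n j : PowerSeries L) * K ^ j) +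
            Ψ * (Nat.multichoose (n + 1) r : PowerSeries L) * K ^ (r + 1) := by
        linear_combination (-Ψ) * this + (∑ j ∈ Finset.range (r + 1),
          (Nat.multichoose (n + 1) j : PowerSeries L) * K ^ j) * hΨ
      rw [h2]
      exact dvd_add (ih.mul_left _) (hXK.mul_left _)
  have h3 : Φ ^ n = PowerSeries.C (e⁻¹ ^ n) * Ψ ^ n := by
    rw [map_pow, ← mul_pow]
    congr 1
    linear_combination -Φ * hee
  have h4 := PowerSeries.X_pow_dvd_iff.1 key r (Nat.lt_succ_self r)
  rw [map_sub, sub_eq_zero] at h4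
  rw [h3, PowerSeries.coeff_C_mul, h4, map_sum, Finset.mul_sum]
  refine Finset.sum_congr rfl fun j _ => ?_
  have h5 : (Nat.multichoose n j : PowerSeries L) * K ^ j =
      PowerSeries.C ((Nat.multichoose n j : L) * e⁻¹ ^ j) * E ^ j := by
    rw [hK, mul_pow, map_mul, map_pow, map_natCast, mul_assoc]
  rw [h5, PowerSeries.coeff_C_mul, pow_add]
  ring

lemma tendsto_coeff_pow {L : Type*} [NormedField L] {f : ℕ → PowerSeries L} {g : PowerSeries L}
    (h : ∀ n, Tendsto (fun d => PowerSeries.coeff n (f d)) atTop (𝓝 (PowerSeries.coeff n g))) (j n : ℕ) :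
    Tendsto (fun d => PowerSeries.coeff n (f d ^ j)) atTop (𝓝 (PowerSeries.coeff n (g ^ j))) := by
  induction j generalizing n with
  | zero => simp
  | succ j ih =>
    simp only [pow_succ, PowerSeries.coeff_mul]
    exact tendsto_finsetSum _ fun p _ => (ih p.1).mul (h p.2)

end PowerSeries

/-! ### Goss polynomials from the logarithmic derivative -/

section GossPolynomials

variable {F : Type*} [Field F] [Finite F]

/-- The logarithmic derivative of `addPoly`, expanded at a point outside of `F[θ]`. -/
lemma sum_invUnitsSub_mul {L : Type*} [Field L] {ι : F[X] →+* L} (hι : Function.Injective ι)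
    (d : ℕ) {z : L} (hz : ∀ a, z - ι a ≠ 0) :
    (∑ a ∈ polysLT F d, PowerSeries.invUnitsSub (Units.mk0 _ (hz a))) *
      (PowerSeries.C ((addPoly ι d).eval z) - (addPoly ι d : PowerSeries L)) = 1 := by
  classical
  obtain ⟨k, hk⟩ := addPoly_eq_prod hι d
  have h1 : C ((addPoly ι d).eval z) - addPoly ι d =
      C k * ∏ a ∈ polysLT F d, (C (z - ι a) - X) := by
    rw [← addPoly_comp_C_sub_X, hk]
    simp only [mul_comp, C_comp, prod_comp, sub_comp, X_comp, C_sub]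
    congr 1
    exact Finset.prod_congr rfl fun a _ => by ring
  -- Differentiation of `h1` in `X`: both sides acquire the sign `-1`, which cancels.
  have h2 : C k * ∑ a ∈ polysLT F d, ∏ b ∈ (polysLT F d).erase a, (C (z - ι b) - X) = 1 := by
    have := congrArg derivative h1
    rw [derivative_mul, derivative_prod_finset, derivative_sub, derivative_addPoly] at this
    simp only [derivative_C, derivative_sub, derivative_X, zero_mul, zero_add, zero_sub, mul_neg,
      mul_one, Finset.sum_neg_distrib, neg_inj] at this
    exact this.symm
  have h3 (a : F[X]) (ha : a ∈ polysLT F d) :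
      PowerSeries.invUnitsSub (Units.mk0 _ (hz a)) *
        ((∏ b ∈ polysLT F d, (C (z - ι b) - X) : L[X]) : PowerSeries L) =
        ((∏ b ∈ (polysLT F d).erase a, (C (z - ι b) - X) : L[X]) : PowerSeries L) := by
    rw [← Finset.mul_prod_erase _ _ ha, Polynomial.coe_mul, ← mul_assoc]
    have := PowerSeries.invUnitsSub_mul_sub (Units.mk0 _ (hz a))
    rw [Polynomial.coe_sub, Polynomial.coe_C, Polynomial.coe_X]
    rw [Units.val_mk0] at this
    rw [this, one_mul]
  rw [← Polynomial.coe_C, ← Polynomial.coe_sub, h1, Polynomial.coe_mul, mul_left_comm,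
    Finset.sum_mul, Finset.sum_congr rfl h3]
  simp only [← Polynomial.coeToPowerSeries.ringHom_apply]
  rw [← map_sum, ← map_mul, h2, map_one]

/-- The coefficient of `X^r` in `∑ 1/(z - a - X) = 1/(e_d(z) - e_d(X))`. -/
lemma sum_inv_sub_pow {L : Type*} [Field L] {ι : F[X] →+* L} (hι : Function.Injective ι)
    (d r : ℕ) {z : L} (hz : ∀ a, z - ι a ≠ 0) (he : (addPoly ι d).eval z ≠ 0) :
    ∑ a ∈ polysLT F d, 1 / (z - ι a) ^ (r + 1) =
      ∑ j ∈ Finset.range (r + 1), ((addPoly ι d).eval z)⁻¹ ^ (j + 1) *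
        PowerSeries.coeff r ((addPoly ι d : PowerSeries L) ^ j) := by
  have h0 : PowerSeries.constantCoeff (addPoly ι d : PowerSeries L) = 0 := by
    have := eval_addPoly_of_degree_lt hι (a := 0) (d := d) (by simp)
    rw [map_zero, ← coeff_zero_eq_eval_zero] at this
    simpa using this
  have h := coeff_pow_of_mul_C_sub_eq_one he h0 (sum_invUnitsSub_mul hι d hz) 1 r
  rw [pow_one, map_sum] at h
  simp only [PowerSeries.coeff_invUnitsSub] at h
  convert h using 2
  · simp [divp]
  · rw [Nat.multichoose_one, Nat.cast_one, one_mul, add_comm]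

variable (F) in
/-- The power series of the Carlitz exponential. -/
def carlitzSeries : PowerSeries (CInfty F) :=
  PowerSeries.mk fun n => ∑ i ∈ Finset.range (n + 1),
    if n = Nat.card F ^ i then (carlitzD F i)⁻¹ else 0

lemma coeff_carlitzSeries_pow (i : ℕ) :
    PowerSeries.coeff (Nat.card F ^ i) (carlitzSeries F) = (carlitzD F i)⁻¹ := by
  have hinj := Nat.pow_right_injective (Finite.one_lt_card (α := F))
  rw [carlitzSeries, PowerSeries.coeff_mk, Finset.sum_eq_single i]
  · simp
  · exact fun j _ hj => if_neg fun h => hj (hinj h).symm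
  · intro h
    have := (Nat.lt_pow_self (n := i) (Finite.one_lt_card (α := F))).le
    exact absurd (Finset.mem_range.2 (by omega)) h

lemma coeff_carlitzSeries_of_notMem {n : ℕ} (hn : n ∉ Set.range fun i => Nat.card F ^ i) :
    PowerSeries.coeff n (carlitzSeries F) = 0 := by
  rw [carlitzSeries, PowerSeries.coeff_mk]
  exact Finset.sum_eq_zero fun i _ => if_neg fun h => hn ⟨i, h.symm⟩

lemma coeff_one_carlitzSeries : PowerSeries.coeff 1 (carlitzSeries F) = 1 := by
  simpa [carlitzD] using coeff_carlitzSeries_pow (F := F) 0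

lemma constantCoeff_carlitzSeries : PowerSeries.constantCoeff (carlitzSeries F) = 0 := by
  rw [← PowerSeries.coeff_zero_eq_constantCoeff_apply]
  exact coeff_carlitzSeries_of_notMem fun ⟨i, hi⟩ => (pow_pos (card_pos' F) i).ne' hi

/-- `e_C(X)` is `X` times a series with constant term `1`. This makes the Goss polynomial monic. -/
lemma coeff_carlitzSeries_pow_self (r : ℕ) :
    PowerSeries.coeff r (carlitzSeries F ^ r) = 1 := by
  obtain ⟨g, hg⟩ := PowerSeries.X_dvd_iff.2 (constantCoeff_carlitzSeries (F := F))
  have h1 : PowerSeries.constantCoeff g = 1 := by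
    have := coeff_one_carlitzSeries (F := F)
    rwa [hg, show 1 = 0 + 1 from rfl, PowerSeries.coeff_succ_X_mul,
      PowerSeries.coeff_zero_eq_constantCoeff_apply] at this
  rw [hg, mul_pow, PowerSeries.coeff_X_pow_mul', if_pos le_rfl, Nat.sub_self,
    PowerSeries.coeff_zero_eq_constantCoeff_apply, map_pow, h1, one_pow]

lemma hasSum_carlitzSeries (w : CInfty F) :
    HasSum (fun n => PowerSeries.coeff n (carlitzSeries F) * w ^ n) (carlitzExp w) := by
  rw [← (Nat.pow_right_injective (Finite.one_lt_card (α := F))).hasSum_iff]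
  · convert! hasSum_carlitzExp w using 2 with i
    rw [Function.comp_apply, coeff_carlitzSeries_pow, div_eq_mul_inv, mul_comm]
  · intro n hn
    rw [coeff_carlitzSeries_of_notMem hn, zero_mul]

variable {ξ : CInfty F}

/-- The series `π̃ e_d(X/π̃)` belongs to the lattice `Λ_C` cut off at degree `d`. Coefficientwise
convergence suffices, as each `β_{r,j}` is a polynomial in finitely many coefficients. -/
lemma tendsto_coeff_addPoly (hξ : ξ ^ (Nat.card F - 1) = -theta F) (n : ℕ) :
    Tendsto (fun d => PowerSeries.coeff n (PowerSeries.C (carlitzPeriod ξ) *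
      PowerSeries.rescale (carlitzPeriod ξ)⁻¹ (addPoly (ofA F) d : PowerSeries (CInfty F))))
      atTop (𝓝 (PowerSeries.coeff n (carlitzSeries F))) := by
  have hπ := carlitzPeriod_ne_zero hξ
  have h1 : (fun d => PowerSeries.coeff n (PowerSeries.C (carlitzPeriod ξ) *
      PowerSeries.rescale (carlitzPeriod ξ)⁻¹ (addPoly (ofA F) d : PowerSeries (CInfty F))))
      =ᶠ[atTop] fun d => ∑ i ∈ Finset.range (n + 1),
        if n = Nat.card F ^ i then (carlitzD F i)⁻¹ * coeffRatio F d i else 0 := by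
    filter_upwards [eventually_ge_atTop n] with d hd
    rw [PowerSeries.coeff_C_mul, PowerSeries.coeff_rescale, Polynomial.coeff_coe,
      addPoly_eq_sum ofA_injective, finsetSum_coeff, Finset.mul_sum, Finset.mul_sum]
    rw [← Finset.sum_subset (Finset.range_subset_range.2 (Nat.succ_le_succ hd))]
    · refine Finset.sum_congr rfl fun i hi => ?_
      rw [coeff_C_mul_X_pow]
      split_ifs with h
      · rw [mul_left_comm, carlitzPeriod_mul_coeff hξ
          ((Nat.lt_succ_iff.1 (Finset.mem_range.1 hi)).trans hd), h, inv_pow]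
        field_simp
      · simp
    · intro i _ hi
      rw [Finset.mem_range, not_lt] at hi
      have := (Nat.lt_pow_self (n := i) (Finite.one_lt_card (α := F)))
      rw [coeff_C_mul_X_pow, if_neg (by omega)]
      simp
  refine Tendsto.congr' h1.symm ?_
  rw [carlitzSeries, PowerSeries.coeff_mk]
  refine tendsto_finsetSum _ fun i _ => ?_
  split_ifs
  · simpa using (tendsto_coeffRatio i).const_mul (carlitzD F i)⁻¹
  · exact tendsto_const_nhds

lemma sum_inv_sub_lattice_pow (hξ : ξ ^ (Nat.card F - 1) = -theta F) (d r : ℕ) {z : CInfty F}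
    (hz : ∀ a, z ≠ ofA F a) :
    ∑ a ∈ polysLT F d, 1 / (carlitzPeriod ξ * z - ofA F a * carlitzPeriod ξ) ^ (r + 1) =
      ∑ j ∈ Finset.range (r + 1),
        (carlitzPeriod ξ * (addPoly (ofA F) d).eval z)⁻¹ ^ (j + 1) *
        PowerSeries.coeff r ((PowerSeries.C (carlitzPeriod ξ) * PowerSeries.rescale
          (carlitzPeriod ξ)⁻¹ (addPoly (ofA F) d : PowerSeries (CInfty F))) ^ j) := by
  have hπ := carlitzPeriod_ne_zero hξ
  have h := sum_inv_sub_pow ofA_injective d r (fun a => sub_ne_zero.2 (hz a))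
    (eval_addPoly_ne_zero hz d)
  have h1 := congrArg (fun x => ((carlitzPeriod ξ)⁻¹) ^ (r + 1) * x) h
  simp only [Finset.mul_sum] at h1
  convert h1 using 2 with a _ j _
  · rw [mul_comm (ofA F a), ← mul_sub, mul_pow, one_div, one_div, mul_inv, inv_pow]
  · rw [mul_pow, ← map_pow, ← map_pow, PowerSeries.coeff_C_mul, PowerSeries.coeff_rescale,
      mul_inv, mul_pow]
    have hc : ((carlitzPeriod ξ)⁻¹) ^ (j + 1) * carlitzPeriod ξ ^ j = (carlitzPeriod ξ)⁻¹ := by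
      rw [pow_succ', mul_assoc, ← mul_pow, inv_mul_cancel₀ hπ, one_pow, mul_one]
    rw [pow_succ' _ r]
    linear_combination (((addPoly (ofA F) d).eval z)⁻¹ ^ (j + 1) * ((carlitzPeriod ξ)⁻¹) ^ r *
      PowerSeries.coeff r ((addPoly (ofA F) d : PowerSeries (CInfty F)) ^ j)) * hc

variable (F) in
/-- The candidate for the Goss polynomial `G_{r+1}`. -/
def gossPoly (r : ℕ) : (CInfty F)[X] :=
  ∑ j ∈ Finset.range (r + 1), C (PowerSeries.coeff r (carlitzSeries F ^ j)) * X ^ (j + 1)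

lemma coeff_gossPoly {r j : ℕ} (hj : j ≤ r) :
    (gossPoly F r).coeff (j + 1) = PowerSeries.coeff r (carlitzSeries F ^ j) := by
  rw [gossPoly, finsetSum_coeff, Finset.sum_eq_single j]
  · simp
  · intro i _ hi
    rw [coeff_C_mul_X_pow, if_neg (by omega)]
  · intro h
    exact absurd (Finset.mem_range.2 (by omega)) h

lemma degree_gossPoly_sub_lt (r : ℕ) :
    (∑ j ∈ Finset.range r, C (PowerSeries.coeff r (carlitzSeries F ^ j)) * X ^ (j + 1) :
      (CInfty F)[X]).degree < (r + 1 : ℕ) := by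
  rw [degree_lt_iff_coeff_zero]
  intro m hm
  rw [finsetSum_coeff]
  refine Finset.sum_eq_zero fun j hj => ?_
  rw [coeff_C_mul_X_pow, if_neg]
  have := Finset.mem_range.1 hj
  omega

lemma gossPoly_eq (r : ℕ) : gossPoly F r = X ^ (r + 1) +
    ∑ j ∈ Finset.range r, C (PowerSeries.coeff r (carlitzSeries F ^ j)) * X ^ (j + 1) := by
  rw [gossPoly, Finset.sum_range_succ, coeff_carlitzSeries_pow_self, C_1, one_mul, add_comm]

lemma eval_gossPoly (r : ℕ) (t : CInfty F) : (gossPoly F r).eval t =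
    ∑ j ∈ Finset.range (r + 1), t ^ (j + 1) * PowerSeries.coeff r (carlitzSeries F ^ j) := by
  rw [gossPoly, eval_finsetSum]
  exact Finset.sum_congr rfl fun j _ => by rw [eval_C_mul, eval_pow, eval_X, mul_comm]

lemma isGossPolynomial_gossPoly (hξ : ξ ^ (Nat.card F - 1) = -theta F) (r : ℕ) :
    IsGossPolynomial (carlitzLattice ξ) (r + 1) (gossPoly F r) where
  monic := by rw [gossPoly_eq]; exact monic_X_pow_add (degree_gossPoly_sub_lt r)
  natDegree_eq := by
    rw [gossPoly_eq]
    exact natDegree_eq_of_degree_eq_some (by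
      rw [degree_add_eq_left_of_degree_lt (by rw [degree_X_pow]; exact degree_gossPoly_sub_lt r),
        degree_X_pow])
  hasSum := by
    intro w hw
    have hπ := carlitzPeriod_ne_zero hξ
    obtain ⟨z, rfl⟩ : ∃ z, carlitzPeriod ξ * z = w := ⟨w / carlitzPeriod ξ, by field_simp⟩
    have hz (a : F[X]) : z ≠ ofA F a := by
      rintro rfl
      exact hw ⟨a, mul_comm _ _⟩
    rw [latticeExp_carlitzLattice hξ, ← (latticeEquiv hξ).hasSum_iff]
    have hs : Summable ((fun l : carlitzLattice ξ =>
        1 / (carlitzPeriod ξ * z - (l : CInfty F)) ^ (r + 1)) ∘ latticeEquiv hξ) := by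
      -- Over a complete nonarchimedean field, terms tending to `0` suffice; the sum may then be
      -- computed along `polysLT`.
      refine NonarchimedeanAddGroup.summable_of_tendsto_cofinite_zero ?_
      have h1 := (((tendsto_inv_sub_ofA z).const_mul (carlitzPeriod ξ)⁻¹).pow (r + 1))
      rw [mul_zero, zero_pow (Nat.succ_ne_zero r)] at h1
      refine h1.congr fun a => ?_
      rw [Function.comp_apply, latticeEquiv_apply, mul_comm (ofA F a), ← mul_sub, one_div,
        ← mul_inv, inv_pow]
    convert hs.hasSum
    refine tendsto_nhds_unique ?_ (hs.hasSum.comp tendsto_polysLT)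
    have h2 : (fun d => ∑ a ∈ polysLT F d,
        1 / (carlitzPeriod ξ * z - ofA F a * carlitzPeriod ξ) ^ (r + 1)) =
        _ := funext fun d => sum_inv_sub_lattice_pow hξ d r hz
    change Tendsto (fun d => ∑ a ∈ polysLT F d,
        1 / (carlitzPeriod ξ * z - ofA F a * carlitzPeriod ξ) ^ (r + 1)) _ _
    rw [h2, eval_gossPoly]
    refine tendsto_finsetSum _ fun j _ => ?_
    rw [one_div]
    exact (((tendsto_addPoly hξ z).inv₀ (carlitzExp_ne_zero hξ hz)).pow _).mul
      (tendsto_coeff_pow (tendsto_coeff_addPoly hξ) j r)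

end GossPolynomials

/-! ### Uniqueness of the Goss polynomials -/

section Uniqueness

variable {F : Type*} [Field F] [Finite F] {ξ : CInfty F}

/-- At the points `π̃ θ^(-n-1)`, too small to meet `Λ_C`, the function `e_C` has norm `|π̃|
q^(-n-1)`, so its values are distinct. -/
lemma infinite_inv_latticeExp (hξ : ξ ^ (Nat.card F - 1) = -theta F) :
    {t | ∃ w, w ∉ carlitzLattice ξ ∧ t = 1 / latticeExp (carlitzLattice ξ) w}.Infinite := by
  have hπ := carlitzPeriod_ne_zero hξ
  have hq := one_lt_card_real F
  have h1 (n : ℕ) : ‖(theta F ^ (n + 1))⁻¹‖ < 1 := by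
    rw [norm_inv, norm_pow, norm_theta]
    exact inv_lt_one_of_one_lt₀ (one_lt_pow₀ hq (Nat.succ_ne_zero n))
  have h2 (n : ℕ) : ‖latticeExp (carlitzLattice ξ) (carlitzPeriod ξ * (theta F ^ (n + 1))⁻¹)‖ =
      ‖carlitzPeriod ξ‖ * ((Nat.card F : ℝ) ^ (n + 1))⁻¹ := by
    rw [latticeExp_carlitzLattice hξ, norm_carlitzExp hξ (N := 0) (by simpa using h1 n), addPoly,
      eval_X, norm_inv, norm_pow, norm_theta]
  refine Set.infinite_of_injective_forall_mem (f := fun n : ℕ =>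
    1 / latticeExp (carlitzLattice ξ) (carlitzPeriod ξ * (theta F ^ (n + 1))⁻¹))
    (fun m n hmn => ?_) fun n => ⟨_, ?_, rfl⟩
  · have h3 := congrArg norm hmn
    simp only [one_div, norm_inv, h2, inv_inj] at h3
    have h4 := inv_injective (mul_left_cancel₀ (norm_ne_zero_iff.2 hπ) h3)
    exact Nat.succ_injective (pow_right_injective₀ (zero_lt_one.trans hq) hq.ne' h4)
  · rintro ⟨a, ha⟩
    dsimp only at ha
    rw [mul_comm] at ha
    have ha := mul_left_cancel₀ hπ ha
    rcases eq_or_ne a 0 with rfl | h0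
    · rw [map_zero, zero_eq_inv] at ha
      exact pow_ne_zero _ theta_ne_zero ha.symm
    · have h5 := h1 n
      rw [← ha, norm_ofA h0] at h5
      exact h5.not_ge (one_le_pow₀ hq.le)

lemma isGossPolynomial_unique (hξ : ξ ^ (Nat.card F - 1) = -theta F) {k : ℕ}
    {G H : (CInfty F)[X]} (hG : IsGossPolynomial (carlitzLattice ξ) k G)
    (hH : IsGossPolynomial (carlitzLattice ξ) k H) : G = H := by
  refine eq_of_infinite_eval_eq G H ((infinite_inv_latticeExp hξ).mono ?_)
  rintro t ⟨w, hw, rfl⟩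
  exact (hG.hasSum w hw).unique (hH.hasSum w hw)

lemma carlitzGoss_succ (hξ : ξ ^ (Nat.card F - 1) = -theta F) (r : ℕ) :
    carlitzGoss ξ (r + 1) = gossPoly F r := by
  have h : ∃ G, IsGossPolynomial (carlitzLattice ξ) (r + 1) G :=
    ⟨_, isGossPolynomial_gossPoly hξ r⟩
  rw [carlitzGoss, dif_pos h]
  exact isGossPolynomial_unique hξ h.choose_spec (isGossPolynomial_gossPoly hξ r)

lemma gossCoeff_eq (hξ : ξ ^ (Nat.card F - 1) = -theta F) {r j : ℕ} (hj : j ≤ r) :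
    gossCoeff ξ r j = PowerSeries.coeff r (carlitzSeries F ^ j) := by
  rw [gossCoeff, carlitzGoss_succ hξ, coeff_gossPoly hj]

end Uniqueness

/-! ### Taylor expansions as formal power series -/

section Taylor

variable {L : Type*} [NontriviallyNormedField L]

/-- `φ` is the Taylor expansion of `f` at `c`. -/
def HasTaylor (f : L → L) (c : L) (φ : PowerSeries L) : Prop :=
  HasFPowerSeriesAt f (FormalMultilinearSeries.ofScalars L fun n => PowerSeries.coeff n φ) c

lemma hasTaylor_iff {f : L → L} {c : L} {φ : PowerSeries L} : HasTaylor f c φ ↔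
    ∀ᶠ h in 𝓝 0, HasSum (fun n => PowerSeries.coeff n φ * h ^ n) (f (c + h)) := by
  simp only [HasTaylor, hasFPowerSeriesAt_iff, FormalMultilinearSeries.coeff_ofScalars,
    smul_eq_mul, mul_comm]

lemma HasTaylor.eventually_summable_norm {f : L → L} {c : L} {φ : PowerSeries L}
    (hf : HasTaylor f c φ) :
    ∀ᶠ h in 𝓝 0, Summable fun n => ‖PowerSeries.coeff n φ * h ^ n‖ := by
  filter_upwards [Metric.eball_mem_nhds 0 hf.radius_pos] with h hh
  refine (FormalMultilinearSeries.summable_norm_apply _ hh).congr fun n => ?_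
  rw [FormalMultilinearSeries.apply_eq_pow_smul_coeff, FormalMultilinearSeries.coeff_ofScalars,
    smul_eq_mul, mul_comm]

lemma HasTaylor.unique {f : L → L} {c : L} {φ ψ : PowerSeries L} (h : HasTaylor f c φ)
    (h' : HasTaylor f c ψ) : φ = ψ := by
  ext n
  have := congrArg (fun p => p.coeff n) (h.eq_formalMultilinearSeries h')
  simpa using this

lemma exists_hasTaylor {f : L → L} {c : L} (h : AnalyticAt L f c) : ∃ φ, HasTaylor f c φ := by
  obtain ⟨p, hp⟩ := h
  refine ⟨PowerSeries.mk p.coeff, hasTaylor_iff.2 ?_⟩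
  simpa only [PowerSeries.coeff_mk, smul_eq_mul, mul_comm] using hasFPowerSeriesAt_iff.1 hp

lemma hasSum_coeff_C (a h : L) :
    HasSum (fun n => PowerSeries.coeff n (PowerSeries.C a) * h ^ n) a := by
  have := hasSum_single (f := fun n => PowerSeries.coeff n (PowerSeries.C a) * h ^ n) 0
    fun n hn => by simp [PowerSeries.coeff_C, hn]
  simpa using this

lemma hasTaylor_one (c : L) : HasTaylor (fun _ => 1) c 1 := by
  refine hasTaylor_iff.2 (Eventually.of_forall fun h => ?_)
  simpa using hasSum_coeff_C (1 : L) h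

lemma HasTaylor.mul [CompleteSpace L] {f g : L → L} {c : L} {φ ψ : PowerSeries L}
    (hf : HasTaylor f c φ) (hg : HasTaylor g c ψ) :
    HasTaylor (fun w => f w * g w) c (φ * ψ) := by
  refine hasTaylor_iff.2 ?_
  filter_upwards [hasTaylor_iff.1 hf, hasTaylor_iff.1 hg, hf.eventually_summable_norm,
    hg.eventually_summable_norm] with h h1 h2 h3 h4
  have h5 (n : ℕ) : PowerSeries.coeff n (φ * ψ) * h ^ n = ∑ p ∈ Finset.HasAntidiagonal.antidiagonal n,
      (PowerSeries.coeff p.1 φ * h ^ p.1) * (PowerSeries.coeff p.2 ψ * h ^ p.2) := by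
    rw [PowerSeries.coeff_mul, Finset.sum_mul]
    refine Finset.sum_congr rfl fun p hp => ?_
    rw [← Finset.HasAntidiagonal.mem_antidiagonal.1 hp, pow_add]
    ring
  simp only [h5]
  rw [← h1.tsum_eq, ← h2.tsum_eq, tsum_mul_tsum_eq_tsum_sum_antidiagonal_of_summable_norm h3 h4]
  exact (summable_norm_sum_mul_antidiagonal_of_summable_norm h3 h4).of_norm.hasSum

lemma HasTaylor.pow [CompleteSpace L] {f : L → L} {c : L} {φ : PowerSeries L}
    (hf : HasTaylor f c φ) (n : ℕ) : HasTaylor (fun w => f w ^ n) c (φ ^ n) := by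
  induction n with
  | zero => simpa using hasTaylor_one c
  | succ n ih => simpa only [pow_succ] using ih.mul hf

lemma HasTaylor.congr {f g : L → L} {c : L} {φ : PowerSeries L}
    (hf : HasTaylor f c φ) (h : f =ᶠ[𝓝 c] g) : HasTaylor g c φ :=
  HasFPowerSeriesAt.congr hf h

lemma hyperDeriv_of_hasTaylor {F : Type*} [Field F] [Finite F] {f : CInfty F → CInfty F}
    {c : CInfty F} {φ : PowerSeries (CInfty F)} (h : HasTaylor f c φ) (r : ℕ) :
    hyperDeriv r f c = PowerSeries.coeff r φ := by
  rw [hyperDeriv_eq h, FormalMultilinearSeries.coeff_ofScalars]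

end Taylor

/-! ### Hyperderivatives of the powers of `u` -/

section HyperDerivatives

variable {F : Type*} [Field F] [Finite F] {ξ : CInfty F}

lemma ne_ofA_of_mem_upperHalfPlane {z : CInfty F} (hz : z ∈ upperHalfPlane F) (a : F[X]) :
    z ≠ ofA F a := by
  rintro rfl
  exact hz ⟨_, rfl⟩

lemma hasTaylor_carlitzExp (hξ : ξ ^ (Nat.card F - 1) = -theta F) (z : CInfty F) :
    HasTaylor (fun w => carlitzExp (carlitzPeriod ξ * w)) z
      (PowerSeries.C (carlitzExp (carlitzPeriod ξ * z)) +
        PowerSeries.rescale (carlitzPeriod ξ) (carlitzSeries F)) := by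
  refine hasTaylor_iff.2 (Eventually.of_forall fun h => ?_)
  rw [carlitzExp_add hξ]
  have h1 := hasSum_carlitzSeries (carlitzPeriod ξ * h)
  have h2 := hasSum_coeff_C (carlitzExp (carlitzPeriod ξ * z)) h
  convert! h2.add h1 using 2 with n
  rw [map_add, PowerSeries.coeff_rescale, mul_pow]
  ring

lemma rescale_C {R : Type*} [CommRing R] (a b : R) :
    PowerSeries.rescale b (PowerSeries.C a) = PowerSeries.C a := by
  ext n
  rw [PowerSeries.coeff_rescale, PowerSeries.coeff_C]
  split_ifs with h <;> simp [h]

/-- Only exponents `q^i` occur, and `(-1)^q = -1` also for even `q`, where `-1 = 1`. -/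
lemma rescale_neg_one_carlitzSeries :
    PowerSeries.rescale (-1) (carlitzSeries F) = -carlitzSeries F := by
  ext n
  rw [PowerSeries.coeff_rescale, map_neg]
  by_cases hn : n ∈ Set.range fun i => Nat.card F ^ i
  · obtain ⟨i, rfl⟩ := hn
    have : (-1 : CInfty F) ^ Nat.card F ^ i = -1 := by
      induction i with
      | zero => simp
      | succ i ih => rw [pow_succ, pow_mul, ih, neg_pow_card (ofA F), one_pow]
    dsimp only
    rw [this, neg_one_mul]
  · rw [coeff_carlitzSeries_of_notMem hn, mul_zero, neg_zero]

/-- The hyperderivatives of the powers of the parameter at infinity. -/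
lemma thetaOp_uParam_pow (hξ : ξ ^ (Nat.card F - 1) = -theta F) (n r : ℕ) {z : CInfty F}
    (hz : z ∈ upperHalfPlane F) :
    thetaOp ξ r (fun w => uParam ξ w ^ n) z = ∑ j ∈ Finset.range (r + 1),
      (Nat.multichoose n j : CInfty F) * gossCoeff ξ r j * uParam ξ z ^ (n + j) := by
  have hπ := carlitzPeriod_ne_zero hξ
  have he := carlitzExp_ne_zero hξ (ne_ofA_of_mem_upperHalfPlane hz)
  have hT := hasTaylor_carlitzExp hξ z
  have han : AnalyticAt (CInfty F) (fun w => carlitzExp (carlitzPeriod ξ * w)) z := ⟨_, hT⟩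
  obtain ⟨Φ, hΦ⟩ := exists_hasTaylor (han.inv he)
  have hu : HasTaylor (uParam ξ) z Φ := hΦ.congr (Eventually.of_forall fun w => by
    simp [uParam])
  have h1 : Φ * (PowerSeries.C (carlitzExp (carlitzPeriod ξ * z)) +
      PowerSeries.rescale (carlitzPeriod ξ) (carlitzSeries F)) = 1 := by
    -- The product of `u` and `e_C(π̃ ·)` is `1` near `z`, where `e_C(π̃ ·)` does not vanish;
    -- uniqueness of Taylor expansions makes this a formal identity.
    refine (hu.mul hT).unique ((hasTaylor_one z).congr ?_)
    filter_upwards [han.continuousAt.eventually_ne he] with w hw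
    rw [uParam, one_div, inv_mul_cancel₀ hw]
  -- Rescaling by `(-π̃)^(-1)` builds in the normalization of `Θ^r` and, by oddness, turns
  -- `e_C(π̃X)` into `-e_C(X)`.
  have h2 := congrArg (PowerSeries.rescale (-carlitzPeriod ξ)⁻¹) h1
  have hc : carlitzPeriod ξ * (-carlitzPeriod ξ)⁻¹ = -1 := by
    rw [inv_neg, mul_neg, mul_inv_cancel₀ hπ]
  rw [map_mul, map_add, map_one, rescale_C, PowerSeries.rescale_rescale, hc,
    rescale_neg_one_carlitzSeries, ← sub_eq_add_neg] at h2
  have h3 := coeff_pow_of_mul_C_sub_eq_one he constantCoeff_carlitzSeries h2 n r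
  rw [← map_pow, PowerSeries.coeff_rescale] at h3
  rw [thetaOp, hyperDeriv_of_hasTaylor (hu.pow n), one_div, ← inv_pow, h3]
  refine Finset.sum_congr rfl fun j hj => ?_
  rw [gossCoeff_eq hξ (Nat.lt_succ_iff.1 (Finset.mem_range.1 hj)), uParam, one_div]
  ring

end HyperDerivatives

/-! ### Holomorphy of the powers of `u` -/

section Holomorphic

lemma norm_pow_sub_pow_le {L : Type*} [NormedField L] [IsUltrametricDist L] {B : ℝ} (hB : 1 ≤ B)
    {x y : L} (hx : ‖x‖ ≤ B) (hy : ‖y‖ ≤ B) (k : ℕ) : ‖x ^ k - y ^ k‖ ≤ B ^ k * ‖x - y‖ := by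
  induction k with
  | zero => simp
  | succ k ih =>
    have h : x ^ (k + 1) - y ^ (k + 1) = x * (x ^ k - y ^ k) + y ^ k * (x - y) := by ring
    rw [h]
    refine (IsUltrametricDist.norm_add_le_max _ _).trans (max_le ?_ ?_)
    · rw [norm_mul, pow_succ', mul_assoc]
      exact mul_le_mul hx ih (norm_nonneg _) (zero_le_one.trans hB)
    · rw [norm_mul, norm_pow]
      refine mul_le_mul_of_nonneg_right ?_ (norm_nonneg _)
      exact (pow_le_pow_left₀ (norm_nonneg _) hy k).trans (pow_le_pow_right₀ hB (Nat.le_succ k))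

lemma uniformContinuousOn_pow_closedBall {L : Type*} [NormedField L] [IsUltrametricDist L]
    {B : ℝ} (hB : 1 ≤ B) (k : ℕ) :
    UniformContinuousOn (fun x : L => x ^ k) (Metric.closedBall 0 B) := by
  rw [Metric.uniformContinuousOn_iff_le]
  intro ε hε
  have hBk : 0 < B ^ k := pow_pos (zero_lt_one.trans_le hB) k
  refine ⟨ε / B ^ k, by positivity, fun x hx y hy hxy => ?_⟩
  rw [dist_eq_norm] at hxy ⊢
  refine (norm_pow_sub_pow_le hB (by simpa using hx) (by simpa using hy) k).trans ?_
  rwa [le_div_iff₀' hBk] at hxy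

lemma uniformContinuousOn_inv_pow {L : Type*} [NormedField L] [IsUltrametricDist L]
    {δ : ℝ} (hδ : 0 < δ) (k : ℕ) :
    UniformContinuousOn (fun x : L => 1 / x ^ k) {x | δ ≤ ‖x‖} := by
  have h1 : UniformContinuousOn (Inv.inv : L → L) {x | δ ≤ ‖x‖} := by
    refine uniformContinuousOn_inv₀ ?_
    filter_upwards [Metric.ball_mem_nhds (0 : L) hδ] with x hx
    simpa using hx
  have h2 := (uniformContinuousOn_pow_closedBall (L := L) (le_max_left 1 δ⁻¹) k).comp h1 (by
    intro x (hx : δ ≤ ‖x‖)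
    rw [mem_closedBall_zero_iff, norm_inv]
    exact (inv_anti₀ hδ hx).trans (le_max_right _ _))
  refine h2.congr fun x _ => ?_
  simp

variable {F : Type*} [Field F] [Finite F] {ξ : CInfty F}

lemma norm_lt_of_mem_affinoid {n : ℕ} {z : CInfty F} (hz : z ∈ affinoid F n) :
    ‖z‖ < (Nat.card F : ℝ) ^ (n + 1) :=
  hz.1.trans_lt (pow_lt_pow_right₀ (one_lt_card_real F) (Nat.lt_succ_self n))

/-- On `Ω_n` each linear factor `z - a` has norm at least `q^(-n)`, and finitely many of them
determine the norm. Level `n + 1` is used because `norm_carlitzExp` needs a strict bound on `|z|`.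
-/
lemma exists_le_norm_carlitzExp (hξ : ξ ^ (Nat.card F - 1) = -theta F) (n : ℕ) :
    ∃ δ : ℝ, 0 < δ ∧ ∀ z ∈ affinoid F n, δ ≤ ‖carlitzExp (carlitzPeriod ξ * z)‖ := by
  obtain ⟨k, hk⟩ := addPoly_eq_prod (ofA_injective (F := F)) (n + 1)
  have hk0 : k ≠ 0 := by
    rintro rfl
    have := derivative_addPoly (ofA F) (n + 1)
    simp [hk] at this
  have hq : 0 < ((Nat.card F : ℝ) ^ n)⁻¹ :=
    inv_pos.2 (pow_pos (zero_lt_one.trans (one_lt_card_real F)) n)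
  refine ⟨‖carlitzPeriod ξ‖ * (‖k‖ * ∏ _a ∈ polysLT F (n + 1), ((Nat.card F : ℝ) ^ n)⁻¹),
    mul_pos (norm_pos_iff.2 (carlitzPeriod_ne_zero hξ)) (mul_pos (norm_pos_iff.2 hk0)
      (Finset.prod_pos fun _ _ => hq)), fun z hz => ?_⟩
  rw [norm_carlitzExp hξ (norm_lt_of_mem_affinoid hz), hk, eval_mul, eval_C, eval_prod, norm_mul,
    norm_prod]
  refine mul_le_mul_of_nonneg_left (mul_le_mul_of_nonneg_left ?_ (norm_nonneg _)) (norm_nonneg _)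
  refine Finset.prod_le_prod (fun _ _ => hq.le) fun a _ => ?_
  rw [eval_sub, eval_X, eval_C]
  exact hz.2 _

lemma isHolomorphic_uParam_pow (hξ : ξ ^ (Nat.card F - 1) = -theta F) (k : ℕ) :
    IsHolomorphic (fun w => uParam ξ w ^ k) := by
  intro n
  obtain ⟨δ, hδ, hδf⟩ := exists_le_norm_carlitzExp hξ n
  have hunif : TendstoUniformlyOn (fun N z => ∑ i ∈ Finset.range N,
      (carlitzPeriod ξ * z) ^ Nat.card F ^ i / carlitzD F i)
      (fun z => carlitzExp (carlitzPeriod ξ * z)) atTop (affinoid F n) := by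
    refine tendstoUniformlyOn_tsum_nat (summable_norm_bound F
      (‖carlitzPeriod ξ‖ * (Nat.card F : ℝ) ^ n) (by positivity)) fun i z hz => ?_
    rw [norm_exp_term]
    gcongr
    rw [norm_mul]
    exact mul_le_mul_of_nonneg_left hz.1 (norm_nonneg _)
  obtain ⟨M, hM⟩ := eventually_atTop.1 (Metric.tendstoUniformlyOn_iff.1 hunif (δ / 2) (by positivity))
  have hS (N : ℕ) (hN : M ≤ N) (z : CInfty F) (hz : z ∈ affinoid F n) :
      δ / 2 ≤ ‖∑ i ∈ Finset.range N, (carlitzPeriod ξ * z) ^ Nat.card F ^ i / carlitzD F i‖ := by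
    have h1 := hM N hN z hz
    rw [dist_eq_norm] at h1
    have h2 := hδf z hz
    have h3 := norm_sub_norm_le (carlitzExp (carlitzPeriod ξ * z))
      (∑ i ∈ Finset.range N, (carlitzPeriod ξ * z) ^ Nat.card F ^ i / carlitzD F i)
    linarith
  have heval (N : ℕ) (z : CInfty F) : ((∑ i ∈ Finset.range N,
      C (carlitzPeriod ξ ^ Nat.card F ^ i / carlitzD F i) * X ^ Nat.card F ^ i) ^ k).eval z =
      (∑ i ∈ Finset.range N, (carlitzPeriod ξ * z) ^ Nat.card F ^ i / carlitzD F i) ^ k := by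
    rw [eval_pow, eval_finsetSum]
    congr 1
    refine Finset.sum_congr rfl fun i _ => ?_
    rw [eval_C_mul, eval_pow, eval_X, mul_pow]
    ring
  -- The approximants are reciprocals of powers of partial sums of `e_C(π̃z)`. The shift by `M`
  -- keeps every partial sum at norm at least `δ / 2`, where inversion is uniformly continuous.
  refine ⟨fun _ => 1, fun m => (∑ i ∈ Finset.range (m + M),
    C (carlitzPeriod ξ ^ Nat.card F ^ i / carlitzD F i) * X ^ Nat.card F ^ i) ^ k, ?_, ?_⟩
  · intro m z hz
    rw [heval]
    exact pow_ne_zero _ (norm_pos_iff.1 ((half_pos hδ).trans_le (hS _ (Nat.le_add_left _ _) z hz)))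
  · simp only [heval, eval_one]
    have h1 : TendstoUniformlyOn (fun m z => ∑ i ∈ Finset.range (m + M),
        (carlitzPeriod ξ * z) ^ Nat.card F ^ i / carlitzD F i)
        (fun z => carlitzExp (carlitzPeriod ξ * z)) atTop (affinoid F n) :=
      fun v hv => (tendsto_add_atTop_nat M).eventually (hunif v hv)
    have h2 : TendstoUniformlyOn (fun m z => 1 / (∑ i ∈ Finset.range (m + M),
        (carlitzPeriod ξ * z) ^ Nat.card F ^ i / carlitzD F i) ^ k)
        (fun z => 1 / carlitzExp (carlitzPeriod ξ * z) ^ k) atTop (affinoid F n) := by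
      rw [Metric.tendstoUniformlyOn_iff] at h1 ⊢
      intro ε hε
      obtain ⟨η, hη, h⟩ := Metric.uniformContinuousOn_iff.1
        (uniformContinuousOn_inv_pow (L := CInfty F) (half_pos hδ) k) ε hε
      filter_upwards [h1 η hη] with m hm z hz
      exact h _ ((half_le_self hδ.le).trans (hδf z hz)) _ (hS _ (Nat.le_add_left _ _) z hz)
        (hm z hz)
    refine h2.congr_right fun z _ => ?_
    simp [uParam]

end Holomorphic

/-! ### Hyperderivatives of Laurent polynomials and binomial coefficients -/

section Laurent

variable {R : Type*}

lemma laurentHyperDeriv_add [CommRing R] (j : ℕ) (f g : R[T;T⁻¹]) :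
    laurentHyperDeriv j (f + g) = laurentHyperDeriv j f + laurentHyperDeriv j g := by
  rw [laurentHyperDeriv, AddMonoidAlgebra.coeff_add]
  exact Finsupp.sum_add_index' (by simp) (by simp [add_mul])

lemma laurentHyperDeriv_C_mul_T [CommRing R] (j : ℕ) (a : R) (m : ℤ) :
    laurentHyperDeriv j (LaurentPolynomial.C a * LaurentPolynomial.T m) =
      LaurentPolynomial.C (Ring.choose m j • a) * LaurentPolynomial.T (m - j) := by
  rw [← LaurentPolynomial.single_eq_C_mul_T, laurentHyperDeriv, AddMonoidAlgebra.coeff_single]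
  exact Finsupp.sum_single_index (by simp)

lemma laurentEval_add [Field R] (x : R) (f g : R[T;T⁻¹]) :
    laurentEval x (f + g) = laurentEval x f + laurentEval x g := by
  rw [laurentEval, AddMonoidAlgebra.coeff_add]
  exact Finsupp.sum_add_index' (by simp) (by simp [add_mul])

lemma laurentEval_C_mul_T [Field R] (x a : R) (m : ℤ) :
    laurentEval x (LaurentPolynomial.C a * LaurentPolynomial.T m) = a * x ^ m := by
  rw [← LaurentPolynomial.single_eq_C_mul_T, laurentEval, AddMonoidAlgebra.coeff_single]
  exact Finsupp.sum_single_index (by simp)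

lemma laurentEval_hyperDeriv_sum [Field R] (x : R) (j : ℕ) {ι : Type*} (s : Finset ι) (a : ι → R)
    (m : ι → ℤ) :
    laurentEval x (laurentHyperDeriv j
      (∑ i ∈ s, LaurentPolynomial.C (a i) * LaurentPolynomial.T (m i))) =
      ∑ i ∈ s, (Ring.choose (m i) j : ℤ) * a i * x ^ (m i - j) := by
  classical
  induction s using Finset.induction_on with
  | empty => simp [laurentHyperDeriv, laurentEval]
  | insert i s hi ih =>
    rw [Finset.sum_insert hi, Finset.sum_insert hi, laurentHyperDeriv_add, laurentEval_add, ih,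
      laurentHyperDeriv_C_mul_T, laurentEval_C_mul_T, zsmul_eq_mul]

/-- The upper entry lives in `ℤ` so that `n = j = 0`, where it is `-1`, is covered. -/
lemma choose_add_sub_one (n j : ℕ) :
    Ring.choose ((n : ℤ) + j - 1) j = (Nat.multichoose n j : ℤ) := by
  rw [← Ring.multichoose_eq, Nat.multichoose_eq]
  rfl

/-- The symmetry of binomial coefficients, available once `n + j - 1` and `n - 1` are natural
numbers. -/
lemma choose_add_sub_one' {n : ℕ} (hn : 1 ≤ n) (j : ℕ) :
    Ring.choose ((n : ℤ) + j - 1) (n - 1) = (Nat.multichoose n j : ℤ) := by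
  obtain ⟨m, rfl⟩ := Nat.exists_eq_add_of_le' hn
  rw [Nat.multichoose_eq, show ((m + 1 : ℕ) : ℤ) + j - 1 = ((m + j : ℕ) : ℤ) by push_cast; ring,
    Ring.choose_natCast, show m + 1 + j - 1 = m + j by omega, Nat.add_sub_cancel,
    Nat.choose_symm_add]

end Laurent

end Drinfeld

end

/-! ### The identities for `Θ^r(u^n)` -/

open Drinfeld in
theorem corollaryC {F : Type*} [Field F] [Finite F]
    (ξ : CInfty F) (hξ : ξ ^ (Nat.card F - 1) = -theta F) (r : ℕ) :
    -- `G_{r+1}` is a Goss polynomial of `Λ_C`, the only one, with coefficients `β_{r,j}`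
    ((∃! G, IsGossPolynomial (carlitzLattice ξ) (r + 1) G) ∧
      carlitzGoss ξ (r + 1) = ∑ j ∈ Finset.range (r + 1), C (gossCoeff ξ r j) * X ^ (j + 1)) ∧
    -- the functions `u ^ n` are holomorphic on `Ω`
    (∀ n : ℕ, IsHolomorphic (fun w => uParam ξ w ^ n)) ∧
    -- first formula
    (∀ n : ℕ, 1 ≤ n → ∀ z ∈ upperHalfPlane F,
      thetaOp ξ r (fun w => uParam ξ w ^ n) z =
        uParam ξ z ^ n *
          laurentEval (uParam ξ z) (laurentHyperDeriv (n - 1)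
            (LaurentPolynomial.T ((n : ℤ) - 2) * Polynomial.toLaurent (carlitzGoss ξ (r + 1))))) ∧
    -- second formula
    (∀ n : ℕ, ∀ z ∈ upperHalfPlane F,
      thetaOp ξ r (fun w => uParam ξ w ^ n) z =
        ∑ j ∈ Finset.range (r + 1), gossCoeff ξ r j * uParam ξ z ^ (j + 1) *
          laurentEval (uParam ξ z)
            (laurentHyperDeriv j (LaurentPolynomial.T ((n : ℤ) + j - 1))) ∧
      thetaOp ξ r (fun w => uParam ξ w ^ n) z =
        ∑ j ∈ Finset.range (r + 1),
          ((Ring.choose ((n : ℤ) + j - 1) j : ℤ) : CInfty F) * gossCoeff ξ r j *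
            uParam ξ z ^ (n + j)) := by
  have hG : carlitzGoss ξ (r + 1) =
      ∑ j ∈ Finset.range (r + 1), C (gossCoeff ξ r j) * X ^ (j + 1) := by
    rw [carlitzGoss_succ hξ, gossPoly]
    refine Finset.sum_congr rfl fun j hj => ?_
    rw [gossCoeff_eq hξ (Nat.lt_succ_iff.1 (Finset.mem_range.1 hj))]
  refine ⟨⟨⟨gossPoly F r, isGossPolynomial_gossPoly hξ r, fun G hG =>
    isGossPolynomial_unique hξ hG (isGossPolynomial_gossPoly hξ r)⟩, hG⟩,
    isHolomorphic_uParam_pow hξ, fun n hn z hz => ?_, fun n z hz => ⟨?_, ?_⟩⟩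
  · have h1 : LaurentPolynomial.T ((n : ℤ) - 2) * Polynomial.toLaurent (carlitzGoss ξ (r + 1)) =
        ∑ j ∈ Finset.range (r + 1), LaurentPolynomial.C (gossCoeff ξ r j) *
          LaurentPolynomial.T ((n : ℤ) + j - 1) := by
      rw [hG, map_sum, Finset.mul_sum]
      refine Finset.sum_congr rfl fun j _ => ?_
      rw [Polynomial.toLaurent_C_mul_X_pow, mul_left_comm, ← LaurentPolynomial.T_add]
      congr 2
      push_cast
      ring
    rw [thetaOp_uParam_pow hξ n r hz, h1, laurentEval_hyperDeriv_sum, Finset.mul_sum]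
    refine Finset.sum_congr rfl fun j _ => ?_
    rw [choose_add_sub_one' hn, show (n : ℤ) + j - 1 - ((n - 1 : ℕ) : ℤ) = j by omega,
      zpow_natCast, Int.cast_natCast, pow_add]
    ring
  · rw [thetaOp_uParam_pow hξ n r hz]
    -- Needed for the exponent `n - 1`, which is negative when `n = 0`.
    have hu : uParam ξ z ≠ 0 :=
      one_div_ne_zero (carlitzExp_ne_zero hξ (ne_ofA_of_mem_upperHalfPlane hz))
    refine Finset.sum_congr rfl fun j _ => ?_
    have h1 := laurentEval_hyperDeriv_sum (uParam ξ z) j {()} (fun _ => 1)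
      (fun _ => (n : ℤ) + j - 1)
    simp only [Finset.sum_singleton, map_one, one_mul, mul_one] at h1
    rw [h1, choose_add_sub_one, show (n : ℤ) + j - 1 - j = n - 1 by ring, zpow_sub_one₀ hu,
      zpow_natCast, Int.cast_natCast]
    field_simp
    ring
  · rw [thetaOp_uParam_pow hξ n r hz]
    simp only [choose_add_sub_one, Int.cast_natCast]
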